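/- Let $d\ge 1$ and let $\mathcal O\subset\mathbb R^d$ be an open set that satisfies the Poincaré inequality $\lambda_1\|\psi\|_{L^2(\mathcal O)}^2\le\|\nabla\psi\|_{L^2(\mathcal O)}^2$ for all $\psi\in H^1_0(\mathcal O)$, with some constant $\lambda_1>0$. Let $p\in[2,\infty)$ if $1\le d\le 4$, and $p\in\big[2,\frac{2d-4}{d-4}\big]$ if $d\ge 5$. Let $A=-\Delta$ be the Dirichlet Laplacian on $L^2(\mathcal O)$, with domain $D(A)=\{u\in H^1_0(\mathcal O):\Delta u\in L^2(\mathcal O)\}$, where $-\Delta u=f\in L^2(\mathcal O)$ means that $(\nabla u,\nabla v)=(f,v)$ for all $v\in H^1_0(\mathcal O)$. For $K\in\mathbb N$ and $u\in H_0^1(\mathcal O)\cap L^p(\mathcal O)$ put $$E(u)=\|\nabla u\|_{L^2(\mathcal O)}^2+\|u\|_{L^p(\mathcal O)}^p,\qquad \mathfrak g(u)=E(u)\,u,\qquad \mathfrak g^K(u)=\begin{cases}\mathfrak g(u), & E(u)\le K,\\ \dfrac{K^2}{E(u)^2}\,\mathfrak g(u), & E(u)>K,\end{cases}$$ and $\mathfrak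 G^K(u)=Au+|u|^{p-2}u-\mathfrak g^K(u)$ for $u\in D(A)$. Then, for every $K\in\mathbb N$: (i) $\mathfrak G^K$ is well defined from $D(A)$ to $L^2(\mathcal O)$: every $u\in D(A)$ satisfies $u\in L^p(\mathcal O)$ and $|u|^{p-2}u\in L^2(\mathcal O)$. Moreover $D(A)$ is the natural domain of the operator, $$D(A)=\big\{\psi\in L^{2p-2}(\mathcal O)\cap H^1_0(\mathcal O):\ -\Delta\psi+|\psi|^{p-2}\psi-\mathfrak g^K(\psi)\in L^2(\mathcal O)\big\},$$ where $-\Delta\psi+|\psi|^{p-2}\psi-\mathfrak g^K(\psi)$ is understood as a functional on $H^1_0(\mathcal O)$. (ii) For every real $\Gamma\ge C(K):=\big[1+(2+p^2 2^{2p-3})K\lambda_1^{-1}\big]K$, the operator $F=\mathfrak G^K+\Gamma I$ with domain $D(A)$ is m-accretive on $L^2(\mathcal O)$, that is, $(F(u)-F(v),u-v)_{L^2(\mathcal O)}\ge 0$ for all $u,v\in D(A)$, and for every $f\in L^2(\mathcal O)$ there is $u\in D(A)$ with $u+F(u)=f$. -/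

import Mathlib

open MeasureTheory Filter Topology
open scoped ContDiff ENNReal

noncomputable section

/-- Euclidean space `ℝ^d`. -/
abbrev Eu (d : ℕ) : Type := EuclideanSpace ℝ (Fin d)

/-- The real Hilbert space `L²(O)`. -/
abbrev L2 {d : ℕ} (O : Set (Eu d)) : Type := Lp ℝ 2 (volume.restrict O)

/-- The Hilbert space `L²(O; ℝ^d)` of square integrable vector fields. -/
abbrev L2Vec {d : ℕ} (O : Set (Eu d)) : Type := Lp (Eu d) 2 (volume.restrict O)

/-- Test functions: `φ ∈ C_c^∞(O)`. -/
def IsTestFunction {d : ℕ} (O : Set (Eu d)) (φ : Eu d → ℝ) : Prop :=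
  ContDiff ℝ ∞ φ ∧ HasCompactSupport φ ∧ tsupport φ ⊆ O

/-- `u ∈ H¹₀(O)` with `∇u = g`: here `H¹₀(O)` is the closure of `C_c^∞(O)` in the `H¹` norm, so
some test functions `φₙ` satisfy `φₙ → u` in `L²(O)` and `∇φₙ → g` in `L²(O; ℝ^d)`. -/
def HasGradientH10 {d : ℕ} (O : Set (Eu d)) (u : L2 O) (g : L2Vec O) : Prop :=
  ∃ φ : ℕ → Eu d → ℝ, (∀ n, IsTestFunction O (φ n)) ∧
    Tendsto (fun n => eLpNorm (fun x => φ n x - u x) 2 (volume.restrict O)) atTop (𝓝 0) ∧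
    Tendsto (fun n => eLpNorm (fun x => gradient (φ n) x - g x) 2 (volume.restrict O))
      atTop (𝓝 0)

/-- The Sobolev space `H¹₀(O)`, as a subset of `L²(O)`. -/
def H10 {d : ℕ} (O : Set (Eu d)) : Set (L2 O) := {u | ∃ g : L2Vec O, HasGradientH10 O u g}

/-- The gradient `∇u ∈ L²(O; ℝ^d)` of `u ∈ H¹₀(O)`. -/
def gradH10 {d : ℕ} {O : Set (Eu d)} (u : H10 O) : L2Vec O := Classical.choose u.2

/-- `O` satisfies the Poincaré inequality with constant `lam`:
`lam ∫ |ψ|² ≤ ∫ |∇ψ|²` for all `ψ ∈ H¹₀(O)`. -/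
def PoincareInequality {d : ℕ} (O : Set (Eu d)) (lam : ℝ) : Prop :=
  ∀ ψ : H10 O, lam * ‖(ψ : L2 O)‖ ^ 2 ≤ ‖gradH10 ψ‖ ^ 2

/-- For `u ∈ H¹₀(O)` the functional `v ↦ (∇u, ∇v)` on `H¹₀(O)` is represented by `f ∈ L²(O)`,
that is, `-Δu = f`. -/
def IsNegLaplacian {d : ℕ} {O : Set (Eu d)} (u : H10 O) (f : L2 O) : Prop :=
  ∀ v : H10 O, inner ℝ (gradH10 u) (gradH10 v) = inner ℝ f (v : L2 O)

/-- The domain `D(A) = {u ∈ H¹₀(O) : -Δu ∈ L²(O)}` of the Dirichlet Laplacian `A = -Δ`. -/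
def domA {d : ℕ} (O : Set (Eu d)) : Set (L2 O) :=
  {u | ∃ (hu : u ∈ H10 O) (f : L2 O), IsNegLaplacian ⟨u, hu⟩ f}

/-- An element of `D(A)`, regarded as an element of `H¹₀(O)`. -/
def domA.toH10 {d : ℕ} {O : Set (Eu d)} (u : domA O) : H10 O :=
  ⟨(u : L2 O), Exists.elim u.2 fun hu _ => hu⟩

/-- The Dirichlet Laplacian `A : D(A) → L²(O)`, `A u = -Δu`. -/
def opA {d : ℕ} {O : Set (Eu d)} (u : domA O) : L2 O :=
  Classical.choose (Exists.elim u.2 fun _ h => h :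
    ∃ f : L2 O, IsNegLaplacian (domA.toH10 u) f)

/-- The function `|u|^{p-2} u`. -/
def powerFun {d : ℕ} {O : Set (Eu d)} (p : ℝ) (u : L2 O) : Eu d → ℝ :=
  fun x => |u x| ^ (p - 2) * u x

open Classical in
/-- `|u|^{p-2} u` as an element of `L²(O)` (with value `0` when it is not square integrable). -/
def powerL2 {d : ℕ} {O : Set (Eu d)} (p : ℝ) (u : L2 O) : L2 O :=
  if h : MemLp (powerFun p u) 2 (volume.restrict O) then h.toLp (powerFun p u) else 0

/-- `‖∇u‖²_{L²} + ‖u‖^p_{L^p}` for `u ∈ H¹₀(O)`. -/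
def energy {d : ℕ} {O : Set (Eu d)} (p : ℝ) (u : H10 O) : ℝ :=
  ‖gradH10 u‖ ^ 2 + ∫ x in O, |(u : L2 O) x| ^ p

/-- `g(u) = (‖∇u‖²_{L²} + ‖u‖^p_{L^p}) u`. -/
def opg {d : ℕ} {O : Set (Eu d)} (p : ℝ) (u : H10 O) : L2 O := energy p u • (u : L2 O)

/-- The cut-off map `g^K`. -/
def cutg {d : ℕ} {O : Set (Eu d)} (p : ℝ) (K : ℕ) (u : H10 O) : L2 O :=
  if energy p u ≤ K then opg p u else ((K : ℝ) ^ 2 / energy p u ^ 2) • opg p u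

/-- The cut-off operator `G^K : D(A) → L²(O)`, `G^K(u) = A u + |u|^{p-2} u - g^K(u)`. -/
def cutG {d : ℕ} {O : Set (Eu d)} (p : ℝ) (K : ℕ) (u : domA O) : L2 O :=
  opA u + powerL2 p (u : L2 O) - cutg p K (domA.toH10 u)

/-- The set of all `ψ ∈ L^{2p-2}(O) ∩ H¹₀(O)` with `-Δψ + |ψ|^{p-2} ψ - g^K(ψ) ∈ L²(O)`, where the
left side is understood as a functional on `H¹₀(O)`. -/
def maxDomCutG {d : ℕ} (O : Set (Eu d)) (p : ℝ) (K : ℕ) : Set (L2 O) :=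
  {ψ | ∃ hψ : ψ ∈ H10 O, MemLp ψ (ENNReal.ofReal (2 * p - 2)) (volume.restrict O) ∧
    ∃ f : L2 O, ∀ v : H10 O,
      inner ℝ (gradH10 ⟨ψ, hψ⟩) (gradH10 v) + (∫ x in O, powerFun p ψ x * (v : L2 O) x)
        - inner ℝ (cutg p K ⟨ψ, hψ⟩) (v : L2 O) = inner ℝ f (v : L2 O)}

/-- A (nonlinear) map `F : D → H` with domain `D ⊆ H` in a Hilbert space is accretive (monotone). -/
def IsAccretive {H : Type*} [NormedAddCommGroup H] [InnerProductSpace ℝ H] {D : Set H}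
    (F : D → H) : Prop :=
  ∀ x y : D, 0 ≤ inner ℝ (F x - F y) ((x : H) - (y : H))

/-- `F` with domain `D` is m-accretive: it is accretive and `R(I + F) = H`. -/
def IsMAccretive {H : Type*} [NormedAddCommGroup H] [InnerProductSpace ℝ H] {D : Set H}
    (F : D → H) : Prop :=
  IsAccretive F ∧ Set.range (fun x : D => (x : H) + F x) = Set.univ

/- The chosen values `gradH10 u` and `opA u` are the only possible ones, and test functions lie in
`H¹₀(O)`. -/

theorem IsTestFunction.memLp {d : ℕ} {O : Set (Eu d)} {φ : Eu d → ℝ} (h : IsTestFunction O φ) :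
    MemLp φ 2 (volume.restrict O) :=
  (h.1.continuous.memLp_of_hasCompactSupport h.2.1).restrict O

theorem IsTestFunction.continuous_gradient {d : ℕ} {O : Set (Eu d)} {φ : Eu d → ℝ}
    (h : IsTestFunction O φ) : Continuous (gradient φ) :=
  (LinearIsometryEquiv.continuous _).comp (h.1.continuous_fderiv (by simp))

theorem IsTestFunction.memLp_gradient {d : ℕ} {O : Set (Eu d)} {φ : Eu d → ℝ}
    (h : IsTestFunction O φ) : MemLp (gradient φ) 2 (volume.restrict O) := by
  refine (h.continuous_gradient.memLp_of_hasCompactSupport ?_).restrict O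
  exact (h.2.1.fderiv (𝕜 := ℝ)).comp_left (g := (InnerProductSpace.toDual ℝ (Eu d)).symm) (by simp)

theorem IsTestFunction.mem_H10 {d : ℕ} {O : Set (Eu d)} {φ : Eu d → ℝ}
    (h : IsTestFunction O φ) :
    HasGradientH10 O (h.memLp.toLp φ) (h.memLp_gradient.toLp (gradient φ)) := by
  refine ⟨fun _ => φ, fun _ => h, ?_, ?_⟩
  · have : eLpNorm (fun x => φ x - h.memLp.toLp φ x) 2 (volume.restrict O) = 0 := by
      rw [eLpNorm_congr_ae (g := 0) ?_]
      · simp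
      · filter_upwards [h.memLp.coeFn_toLp] with x hx
        simp [hx]
    simp [this]
  · have : eLpNorm (fun x => gradient φ x - h.memLp_gradient.toLp (gradient φ) x) 2
        (volume.restrict O) = 0 := by
      rw [eLpNorm_congr_ae (g := 0) ?_]
      · simp
      · filter_upwards [h.memLp_gradient.coeFn_toLp] with x hx
        simp [hx]
    simp [this]

theorem HasGradientH10.integral_mul {d : ℕ} {O : Set (Eu d)} {u : L2 O} {g : L2Vec O}
    (h : HasGradientH10 O u g) {ψ : Eu d → ℝ} (hψ : IsTestFunction O ψ) (e : Eu d) :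
    ∫ x in O, ψ x * inner ℝ (g x) e = - ∫ x in O, u x * inner ℝ (gradient ψ x) e := by
  obtain ⟨φ, hφ, h1, h2⟩ := h
  have t1 : Tendsto (fun n => (hφ n).memLp.toLp (φ n)) atTop (𝓝 u) := by
    rw [Lp.tendsto_Lp_iff_tendsto_eLpNorm']
    refine h1.congr fun n => eLpNorm_congr_ae ?_
    filter_upwards [(hφ n).memLp.coeFn_toLp] with x hx
    simp [hx]
  have t2 : Tendsto (fun n => (hφ n).memLp_gradient.toLp (gradient (φ n))) atTop (𝓝 g) := by
    rw [Lp.tendsto_Lp_iff_tendsto_eLpNorm']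
    refine h2.congr fun n => eLpNorm_congr_ae ?_
    filter_upwards [(hφ n).memLp_gradient.coeFn_toLp] with x hx
    simp [hx]
  have m1 : MemLp (fun x => ψ x • e) 2 (volume.restrict O) := by
    refine ((hψ.1.continuous.smul continuous_const).memLp_of_hasCompactSupport ?_).restrict O
    exact hψ.2.1.smul_right
  have m2 : MemLp (fun x => inner ℝ (gradient ψ x) e) 2 (volume.restrict O) :=
    hψ.memLp_gradient.inner_const e
  have s1 := t2.inner (𝕜 := ℝ) (tendsto_const_nhds (x := m1.toLp _))
  have s2 := t1.inner (𝕜 := ℝ) (tendsto_const_nhds (x := m2.toLp _))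
  have key : ∀ n, inner ℝ ((hφ n).memLp_gradient.toLp (gradient (φ n))) (m1.toLp _)
      = - inner ℝ ((hφ n).memLp.toLp (φ n)) (m2.toLp _) := by
    intro n
    rw [L2.inner_def, L2.inner_def]
    have e1 : ∫ x in O, inner ℝ ((hφ n).memLp_gradient.toLp (gradient (φ n)) x) (m1.toLp _ x)
        = ∫ x in O, fderiv ℝ (φ n) x e * ψ x := by
      refine integral_congr_ae ?_
      filter_upwards [(hφ n).memLp_gradient.coeFn_toLp, m1.coeFn_toLp] with x hx hx'
      rw [hx, hx', inner_smul_right, mul_comm]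
      simp [gradient, InnerProductSpace.toDual_symm_apply]
    have e2 : ∫ x in O, inner ℝ ((hφ n).memLp.toLp (φ n) x) (m2.toLp _ x)
        = ∫ x in O, φ n x * fderiv ℝ ψ x e := by
      refine integral_congr_ae ?_
      filter_upwards [(hφ n).memLp.coeFn_toLp, m2.coeFn_toLp] with x hx hx'
      rw [hx, hx']
      simp [gradient, InnerProductSpace.toDual_symm_apply, mul_comm]
    rw [e1, e2, setIntegral_eq_integral_of_forall_compl_eq_zero,
      setIntegral_eq_integral_of_forall_compl_eq_zero]
    · have cψ : Continuous fun x => fderiv ℝ ψ x e :=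
        (hψ.1.continuous_fderiv (by simp)).clm_apply continuous_const
      have cφ : Continuous fun x => fderiv ℝ (φ n) x e :=
        ((hφ n).1.continuous_fderiv (by simp)).clm_apply continuous_const
      have := integral_mul_fderiv_eq_neg_fderiv_mul_of_integrable (μ := volume) (f := φ n)
        (g := ψ) (v := e) ?_ ?_ ?_ (fun x _ => ((hφ n).1.differentiable (by simp)) x)
        (fun x _ => (hψ.1.differentiable (by simp)) x)
      · rw [this, neg_neg]
      · exact (cφ.mul hψ.1.continuous).integrable_of_hasCompactSupport hψ.2.1.mul_left
      · exact ((hφ n).1.continuous.mul cψ).integrable_of_hasCompactSupport (hφ n).2.1.mul_right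
      · exact ((hφ n).1.continuous.mul hψ.1.continuous).integrable_of_hasCompactSupport
          (hφ n).2.1.mul_right
    · intro x hx
      rw [image_eq_zero_of_notMem_tsupport fun h => hx ((hφ n).2.2 h), zero_mul]
    · intro x hx
      rw [image_eq_zero_of_notMem_tsupport fun h => hx (hψ.2.2 h), mul_zero]
  have := tendsto_nhds_unique (s1.congr key) s2.neg
  rw [L2.inner_def, L2.inner_def] at this
  have e1 : ∫ x in O, inner ℝ (g x) (m1.toLp _ x) = ∫ x in O, ψ x * inner ℝ (g x) e := by
    refine integral_congr_ae ?_
    filter_upwards [m1.coeFn_toLp] with x hx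
    rw [hx, inner_smul_right]
  have e2 : ∫ x in O, inner ℝ (u x) (m2.toLp _ x)
      = ∫ x in O, u x * inner ℝ (gradient ψ x) e := by
    refine integral_congr_ae ?_
    filter_upwards [m2.coeFn_toLp] with x hx
    rw [hx]
    simp [mul_comm]
  rw [← e1, ← e2, this]

/-- A square integrable function on `O` that is orthogonal to all test functions vanishes. -/
theorem eq_zero_of_test {d : ℕ} {O : Set (Eu d)} (hO : IsOpen O) {f : Eu d → ℝ}
    (hf : MemLp f 2 (volume.restrict O))
    (h : ∀ ψ, IsTestFunction O ψ → ∫ x in O, ψ x * f x = 0) : f =ᵐ[volume.restrict O] 0 := by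
  have hl : LocallyIntegrableOn f O volume :=
    locallyIntegrableOn_of_locallyIntegrable_restrict (hf.locallyIntegrable (by norm_num))
  have := hO.ae_eq_zero_of_integral_contDiff_smul_eq_zero hl fun ψ h1 h2 h3 => by
    rw [← h ψ ⟨h1, h2, h3⟩, setIntegral_eq_integral_of_forall_compl_eq_zero]
    · rfl
    · intro x hx
      rw [image_eq_zero_of_notMem_tsupport fun h => hx (h3 h), zero_mul]
  exact (ae_restrict_iff' hO.measurableSet).2 this

/-- The gradient of an element of `H¹₀(O)` is unique. -/
theorem HasGradientH10.unique {d : ℕ} {O : Set (Eu d)} (hO : IsOpen O) {u : L2 O} {g g' : L2Vec O}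
    (h : HasGradientH10 O u g) (h' : HasGradientH10 O u g') : g = g' := by
  have hc : ∀ i : Fin d, (fun x => inner ℝ (g x - g' x) (EuclideanSpace.single i (1 : ℝ)))
      =ᵐ[volume.restrict O] 0 := by
    intro i
    have hg := (Lp.memLp g).inner_const (𝕜 := ℝ) (EuclideanSpace.single i (1 : ℝ))
    have hg' := (Lp.memLp g').inner_const (𝕜 := ℝ) (EuclideanSpace.single i (1 : ℝ))
    refine eq_zero_of_test hO (((Lp.memLp g).sub (Lp.memLp g')).inner_const _) fun ψ hψ => ?_
    have := (h.integral_mul hψ (EuclideanSpace.single i 1)).trans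
      (h'.integral_mul hψ (EuclideanSpace.single i 1)).symm
    simp only [inner_sub_left, mul_sub]
    exact (integral_sub (hψ.memLp.integrable_mul hg) (hψ.memLp.integrable_mul hg')).trans
      (sub_eq_zero.2 this)
  refine Lp.ext ?_
  filter_upwards [ae_all_iff.2 hc] with x hx
  ext i
  have := hx i
  simp only [EuclideanSpace.inner_single_right, Pi.zero_apply] at this
  simpa [sub_eq_zero] using this

theorem gradH10_spec {d : ℕ} {O : Set (Eu d)} (u : H10 O) : HasGradientH10 O u (gradH10 u) :=
  Classical.choose_spec u.2

/-- The representing element `f = -Δu` is unique. -/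
theorem IsNegLaplacian.unique {d : ℕ} {O : Set (Eu d)} (hO : IsOpen O) {u : H10 O} {f f' : L2 O}
    (h : IsNegLaplacian u f) (h' : IsNegLaplacian u f') : f = f' := by
  have hz := eq_zero_of_test hO ((Lp.memLp f).sub (Lp.memLp f')) fun ψ hψ => by
    have := (h ⟨_, _, hψ.mem_H10⟩).symm.trans (h' ⟨_, _, hψ.mem_H10⟩)
    rw [← sub_eq_zero, ← inner_sub_left, L2.inner_def] at this
    rw [← this]
    refine integral_congr_ae ?_
    filter_upwards [hψ.memLp.coeFn_toLp, Lp.coeFn_sub f f'] with x hx hx'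
    rw [hx, hx']
    simp
  refine Lp.ext ?_
  filter_upwards [hz] with x hx
  simpa [sub_eq_zero] using hx

end

/-!
The operator is `A + β - g^K` with `A = -Δ` the Dirichlet Laplacian, `β(u) = |u|^{p-2} u` and
`g^K(u) = θ(E(u)) u`, where `θ = cutCoeff K` satisfies `θ ≤ K`.

*Domain.* No regularity of `O` is available, so `D(A) ⊂ L^{2p-2}(O)` is proved by an energy estimate.
Let `-Δu = f`, let `t = (1 + ε β)⁻¹ u` pointwise, and test with the Yosida approximation `y = β(t)` of
`β(u)`. The function `w = |t|^{p/2-1} t` satisfies `|∇w|² ≤ c ∇y·∇u`, hence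
`‖∇w‖² ≤ c (f, y)` (`exists_half_power`), and `|w|^r = y²` for `r = 4(p-1)/p`. The bound on `p` is
what gives `H¹₀(O) ⊂ L^r(O)` (`exists_sobolev_H10`). Therefore
`‖y‖² ≤ C ‖∇w‖^r ≤ C' (‖f‖ ‖y‖)^{r/2}` with `r / 2 < 2`, which bounds `y` uniformly in `ε`, and Fatou's
lemma gives `β(u) ∈ L²(O)` (`memLp_power_of_isNegLaplacian`).

*Accretivity.* Write `θ(E(u)) u - θ(E(v)) v = θ(E(u)) (u - v) + (θ(E(u)) - θ(E(v))) v` with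
`E(v) ≤ E(u)`. The difference of the energies is controlled by `‖∇(u - v)‖` and by the square root of
`(β(u) - β(v), u - v)` times `E(u)^{1/2}` (`energy_sub_le`), while `‖v‖ ≤ (E(v)/λ₁)^{1/2}`. The
inequality `|θ(a) - θ(b)| (ab)^{1/2} ≤ K (a - b)` absorbs the energies (`abs_cutCoeff_sub_mul_le`), and
Young's inequality concludes (`inner_cutg_sub_le`).

*Range.* The equation `-Δu + β(u) + μ u = f` is solved for `μ > 0` by Yosida approximation
(`IsMonotoneC1.exists_solution`). The nonlocal term `g^K` only contributes the scalar `θ(E(u))`. Freezing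
it to `θ(s)` gives a solution `u_s` depending continuously on `s`, whose energy
`E(u_s) = (f, u_s) - μ ‖u_s‖²` is continuous in `s` and bounded by `‖f‖²`. By the intermediate value
theorem `E(u_s) = s` for some `s`, and this `u_s` solves the equation (`exists_cut_solution`).
-/

/-! ### The gradient graph -/

section GradientGraph

variable {d : ℕ} {O : Set (Eu d)}

theorem IsTestFunction.zero : IsTestFunction O (0 : Eu d → ℝ) :=
  ⟨contDiff_const, HasCompactSupport.zero, by simp [tsupport]⟩

theorem IsTestFunction.add {φ ψ : Eu d → ℝ} (hφ : IsTestFunction O φ) (hψ : IsTestFunction O ψ) :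
    IsTestFunction O (φ + ψ) :=
  ⟨hφ.1.add hψ.1, hφ.2.1.add hψ.2.1,
    (tsupport_add φ ψ).trans (Set.union_subset hφ.2.2 hψ.2.2)⟩

theorem IsTestFunction.const_smul {φ : Eu d → ℝ} (c : ℝ) (hφ : IsTestFunction O φ) :
    IsTestFunction O (c • φ) :=
  ⟨hφ.1.const_smul c, hφ.2.1.smul_left (f := fun _ => c),
    (tsupport_smul_subset_right (fun _ => c) φ).trans hφ.2.2⟩

theorem IsTestFunction.differentiable {φ : Eu d → ℝ} (hφ : IsTestFunction O φ) :
    Differentiable ℝ φ := hφ.1.differentiable (by simp)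

theorem gradient_add {φ ψ : Eu d → ℝ} (hφ : Differentiable ℝ φ) (hψ : Differentiable ℝ ψ) :
    gradient (φ + ψ) = gradient φ + gradient ψ := by
  ext1 x
  simp [gradient, fderiv_add (hφ x) (hψ x)]

theorem gradient_const_smul {φ : Eu d → ℝ} (c : ℝ) (hφ : Differentiable ℝ φ) :
    gradient (c • φ) = c • gradient φ := by
  ext1 x
  simp [gradient, fderiv_const_smul (hφ x)]

theorem gradient_comp {φ : Eu d → ℝ} {G : ℝ → ℝ} {x : Eu d} {c : ℝ} (hG : HasDerivAt G c (φ x))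
    (hφ : DifferentiableAt ℝ φ x) : gradient (fun y => G (φ y)) x = c • gradient φ x := by
  have : HasFDerivAt (fun y => G (φ y)) (c • fderiv ℝ φ x) x := hG.comp_hasFDerivAt x hφ.hasFDerivAt
  simp [gradient, this.fderiv]

/-- The pairs `(φ, ∇φ)` with `φ` a test function. -/
noncomputable def testGraph (O : Set (Eu d)) : Submodule ℝ (L2 O × L2Vec O) where
  carrier := {x | ∃ (φ : Eu d → ℝ) (h : IsTestFunction O φ),
    x = (h.memLp.toLp φ, h.memLp_gradient.toLp (gradient φ))}
  zero_mem' := by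
    refine ⟨0, IsTestFunction.zero, ?_⟩
    have : gradient (0 : Eu d → ℝ) = 0 := by ext1 x; simp [gradient]
    ext1
    · exact (MemLp.toLp_zero (IsTestFunction.zero (O := O)).memLp).symm
    · exact (Lp.ext (by
        filter_upwards [(IsTestFunction.zero (O := O)).memLp_gradient.coeFn_toLp,
          Lp.coeFn_zero (Eu d) 2 (volume.restrict O)] with x h1 h2
        rw [h1, this]; exact h2.symm)).symm
  add_mem' := by
    rintro _ _ ⟨φ, hφ, rfl⟩ ⟨ψ, hψ, rfl⟩
    refine ⟨φ + ψ, hφ.add hψ, ?_⟩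
    ext1
    · exact (MemLp.toLp_add hφ.memLp hψ.memLp).symm
    · refine ((MemLp.toLp_add hφ.memLp_gradient hψ.memLp_gradient).symm.trans ?_)
      congr 1
      exact (gradient_add hφ.differentiable hψ.differentiable).symm
  smul_mem' := by
    rintro c _ ⟨φ, hφ, rfl⟩
    refine ⟨c • φ, hφ.const_smul c, ?_⟩
    ext1
    · exact (MemLp.toLp_const_smul c hφ.memLp).symm
    · refine ((MemLp.toLp_const_smul c hφ.memLp_gradient).symm.trans ?_)
      congr 1
      exact (gradient_const_smul c hφ.differentiable).symm

/-- The graph of the gradient on `H¹₀(O)`: the closure of `testGraph O` in `L²(O) × L²(O; ℝ^d)`. -/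
noncomputable def gradGraph (O : Set (Eu d)) : Submodule ℝ (L2 O × L2Vec O) := (testGraph O).topologicalClosure

theorem isClosed_gradGraph : IsClosed (gradGraph O : Set (L2 O × L2Vec O)) :=
  Submodule.isClosed_topologicalClosure _

/-- The graph closure is the relation `HasGradientH10`, since closure in a metric space is sequential. -/
theorem mem_gradGraph {u : L2 O} {g : L2Vec O} : (u, g) ∈ gradGraph O ↔ HasGradientH10 O u g := by
  change (u, g) ∈ closure (testGraph O : Set (L2 O × L2Vec O)) ↔ _
  have e1 : ∀ (φ : Eu d → ℝ) (h : IsTestFunction O φ),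
      eLpNorm (fun x => φ x - u x) 2 (volume.restrict O)
        = eLpNorm (⇑(h.memLp.toLp φ) - ⇑u) 2 (volume.restrict O) := by
    intro φ h
    refine eLpNorm_congr_ae ?_
    filter_upwards [h.memLp.coeFn_toLp] with x hx
    simp [hx]
  have e2 : ∀ (φ : Eu d → ℝ) (h : IsTestFunction O φ),
      eLpNorm (fun x => gradient φ x - g x) 2 (volume.restrict O)
        = eLpNorm (⇑(h.memLp_gradient.toLp (gradient φ)) - ⇑g) 2 (volume.restrict O) := by
    intro φ h
    refine eLpNorm_congr_ae ?_
    filter_upwards [h.memLp_gradient.coeFn_toLp] with x hx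
    simp [hx]
  rw [mem_closure_iff_seq_limit]
  constructor
  · rintro ⟨x, hx, ht⟩
    choose φ hφ hx using hx
    rw [Prod.tendsto_iff] at ht
    refine ⟨φ, hφ, ?_, ?_⟩
    · have := (Lp.tendsto_Lp_iff_tendsto_eLpNorm' _ _).1 ht.1
      refine this.congr fun n => ?_
      rw [e1 _ (hφ n), hx n]
    · have := (Lp.tendsto_Lp_iff_tendsto_eLpNorm' _ _).1 ht.2
      refine this.congr fun n => ?_
      rw [e2 _ (hφ n), hx n]
  · rintro ⟨φ, hφ, h1, h2⟩
    refine ⟨fun n => ((hφ n).memLp.toLp (φ n), (hφ n).memLp_gradient.toLp (gradient (φ n))),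
      fun n => ⟨φ n, hφ n, rfl⟩, ?_⟩
    refine Tendsto.prodMk_nhds ?_ ?_
    · rw [Lp.tendsto_Lp_iff_tendsto_eLpNorm']
      exact h1.congr fun n => e1 _ (hφ n)
    · rw [Lp.tendsto_Lp_iff_tendsto_eLpNorm']
      exact h2.congr fun n => e2 _ (hφ n)

theorem HasGradientH10.sub {u v : L2 O} {g h : L2Vec O} (hu : HasGradientH10 O u g)
    (hv : HasGradientH10 O v h) : HasGradientH10 O (u - v) (g - h) :=
  mem_gradGraph.1 ((gradGraph O).sub_mem (mem_gradGraph.2 hu) (mem_gradGraph.2 hv))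

theorem HasGradientH10.of_tendsto {u : ℕ → L2 O} {g : ℕ → L2Vec O} {u₀ : L2 O} {g₀ : L2Vec O}
    (h : ∀ n, HasGradientH10 O (u n) (g n)) (hu : Tendsto u atTop (𝓝 u₀))
    (hg : Tendsto g atTop (𝓝 g₀)) : HasGradientH10 O u₀ g₀ :=
  mem_gradGraph.1 (isClosed_gradGraph.mem_of_tendsto (hu.prodMk_nhds hg)
    (Eventually.of_forall fun n => mem_gradGraph.2 (h n)))

theorem HasGradientH10.mem {u : L2 O} {g : L2Vec O} (h : HasGradientH10 O u g) : u ∈ H10 O := ⟨g, h⟩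

theorem HasGradientH10.gradH10_eq (hO : IsOpen O) {u : L2 O} {g : L2Vec O}
    (h : HasGradientH10 O u g) : gradH10 ⟨u, h.mem⟩ = g :=
  (gradH10_spec ⟨u, h.mem⟩).unique hO h

/-- A closed linear relation between `f` and `(v, ∇v)` only has to be tested on test functions. -/
theorem forall_gradGraph_of_test {f : L2 O} {g : L2Vec O}
    (h : ∀ (φ : Eu d → ℝ) (hφ : IsTestFunction O φ),
      inner ℝ g (hφ.memLp_gradient.toLp (gradient φ)) = inner ℝ f (hφ.memLp.toLp φ))
    {v : L2 O} {k : L2Vec O} (hv : HasGradientH10 O v k) : inner ℝ g k = inner ℝ f v := by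
  have hc : IsClosed {x : L2 O × L2Vec O | inner ℝ g x.2 = inner ℝ f x.1} :=
    isClosed_eq (by fun_prop) (by fun_prop)
  have hs : (testGraph O : Set (L2 O × L2Vec O)) ⊆ {x | inner ℝ g x.2 = inner ℝ f x.1} := by
    rintro _ ⟨φ, hφ, rfl⟩
    exact h φ hφ
  exact closure_minimal hs hc (mem_gradGraph.2 hv)

/-- The equation `-Δu + κ u = f` is uniquely solvable for `κ > 0`. The solution is read off from the
orthogonal projection of `(κ^{-1/2} f, 0)` onto the closed subspace of all `(κ^{1/2} v, ∇v)`. -/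
theorem exists_isNegLaplacian_sub_smul (hO : IsOpen O) {κ : ℝ} (hκ : 0 < κ) (f : L2 O) :
    ∃ u : H10 O, IsNegLaplacian u (f - κ • (u : L2 O)) := by
  set c := Real.sqrt κ with hc
  have hc0 : c ≠ 0 := (Real.sqrt_pos.2 hκ).ne'
  have hcc : c * c = κ := Real.mul_self_sqrt hκ.le
  let E := WithLp 2 (L2 O × L2Vec O)
  let T : E →L[ℝ] L2 O × L2Vec O :=
    ((c⁻¹ • ContinuousLinearMap.fst ℝ (L2 O) (L2Vec O)).prod
      (ContinuousLinearMap.snd ℝ (L2 O) (L2Vec O))).comp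
      (WithLp.prodContinuousLinearEquiv 2 ℝ (L2 O) (L2Vec O)).toContinuousLinearMap
  let W : Submodule ℝ E := (gradGraph O).comap T.toLinearMap
  have hW : IsClosed (W : Set E) := isClosed_gradGraph.preimage T.continuous
  have : CompleteSpace W := hW.completeSpace_coe
  have memW : ∀ x : E, x ∈ W ↔ HasGradientH10 O (c⁻¹ • x.fst) x.snd := fun x => mem_gradGraph
  let z : E := WithLp.toLp 2 (c⁻¹ • f, 0)
  obtain ⟨y, hy, hyz⟩ : ∃ y ∈ W, ∀ w ∈ W, inner ℝ (z - y) w = 0 :=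
    ⟨W.starProjection z, W.starProjection_apply_mem z, fun w hw =>
      W.starProjection_inner_eq_zero z w hw⟩
  have hg := (memW y).1 hy
  refine ⟨⟨_, hg.mem⟩, fun v => ?_⟩
  rw [hg.gradH10_eq hO]
  have hv := gradH10_spec v
  have := hyz (WithLp.toLp 2 (c • (v : L2 O), gradH10 v)) ((memW _).2 (by
    simpa [smul_smul, inv_mul_cancel₀ hc0] using hv))
  rw [WithLp.prod_inner_apply] at this
  replace this : inner ℝ (c⁻¹ • f - y.fst) (c • (v : L2 O))
    + inner ℝ ((0 : L2Vec O) - y.snd) (gradH10 v) = 0 := this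
  simp only [inner_sub_left, inner_smul_left, inner_smul_right, inner_neg_left,
    RCLike.conj_to_real, zero_sub] at this ⊢
  rw [← hcc]
  field_simp
  field_simp at this
  linarith

end GradientGraph

/-! ### The chain rule in `H¹₀(O)` -/

section ChainRule

/-- Dominated convergence in `L²`. -/
theorem tendsto_eLpNorm_two_of_dominated {α E : Type*} [MeasurableSpace α] {μ : Measure α}
    [NormedAddCommGroup E] {F : ℕ → α → E} {bound : α → ℝ}
    (hF : ∀ n, AEStronglyMeasurable (F n) μ) (hb : MemLp bound 2 μ)
    (hle : ∀ n, ∀ᵐ x ∂μ, ‖F n x‖ ≤ bound x)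
    (hlim : ∀ᵐ x ∂μ, Tendsto (fun n => F n x) atTop (𝓝 0)) :
    Tendsto (fun n => eLpNorm (F n) 2 μ) atTop (𝓝 0) := by
  have key : Tendsto (fun n => ∫⁻ x, ‖F n x‖ₑ ^ (2 : ℝ) ∂μ) atTop (𝓝 (∫⁻ _, 0 ∂μ)) := by
    refine tendsto_lintegral_of_dominated_convergence' (fun x => ‖bound x‖ₑ ^ (2 : ℝ))
      (fun n => (hF n).enorm.pow_const _) (fun n => ?_) ?_ ?_
    · filter_upwards [hle n] with x hx
      gcongr
      exact enorm_le_iff_norm_le.2 (hx.trans (le_abs_self _))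
    · have := lintegral_rpow_enorm_lt_top_of_eLpNorm_lt_top (by norm_num) (by norm_num) hb.2
      simpa using this.ne
    · filter_upwards [hlim] with x hx
      have h2 : Continuous fun t : ℝ≥0∞ => t ^ (2 : ℝ) := ENNReal.continuous_rpow_const
      simpa [Function.comp_def] using (h2.tendsto _).comp hx.enorm
  have h3 : Continuous fun t : ℝ≥0∞ => t ^ (1 / 2 : ℝ) := ENNReal.continuous_rpow_const
  have := (h3.tendsto _).comp key
  simp only [lintegral_zero] at this
  convert this using 2
  · rename_i n
    rw [eLpNorm_eq_lintegral_rpow_enorm_toReal (by norm_num) (by norm_num)]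
    simp
  · simp

variable {d : ℕ} {O : Set (Eu d)}

theorem IsTestFunction.comp {φ : Eu d → ℝ} (hφ : IsTestFunction O φ) {G : ℝ → ℝ}
    (hG : ContDiff ℝ ∞ G) (h0 : G 0 = 0) : IsTestFunction O (fun x => G (φ x)) :=
  ⟨hG.comp hφ.1, hφ.2.1.comp_left h0, (closure_mono (by
    intro x hx hx'
    exact hx (by simp [hx', h0]))).trans hφ.2.2⟩

/-- The chain rule `∇(G(u)) = G'(u) ∇u` for smooth `G`, by applying `G` to the approximating test
functions. -/
theorem HasGradientH10.comp_smooth {u : L2 O} {g : L2Vec O} (hu : HasGradientH10 O u g) {G : ℝ → ℝ}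
    (hG : ContDiff ℝ ∞ G) (h0 : G 0 = 0) {L : ℝ} (hL : ∀ s, |deriv G s| ≤ L) {w : L2 O}
    {h : L2Vec O} (hw : ∀ᵐ x ∂volume.restrict O, w x = G (u x))
    (hh : ∀ᵐ x ∂volume.restrict O, h x = deriv G (u x) • g x) : HasGradientH10 O w h := by
  have hL0 : 0 ≤ L := (abs_nonneg _).trans (hL 0)
  have hGd : Differentiable ℝ G := hG.differentiable (by simp)
  have hG' : Continuous (deriv G) := hG.continuous_deriv (by simp)
  have hLip : ∀ a b, |G a - G b| ≤ L * |a - b| := fun a b => by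
    simpa [Real.norm_eq_abs] using Convex.norm_image_sub_le_of_norm_deriv_le
      (f := G) (s := Set.univ) (C := L) (fun x _ => hGd x) (fun x _ => by simpa using hL x)
      convex_univ (Set.mem_univ b) (Set.mem_univ a)
  obtain ⟨φ, hφ, h1, h2⟩ := hu
  obtain ⟨ns, hns, hae⟩ := (tendstoInMeasure_of_tendsto_eLpNorm (g := fun x => u x) (by norm_num)
    (fun n => (hφ n).memLp.1) (Lp.memLp u).1 h1).exists_seq_tendsto_ae
  refine ⟨fun n x => G (φ (ns n) x), fun n => (hφ _).comp hG h0, ?_, ?_⟩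
  · have := ENNReal.Tendsto.const_mul (h1.comp hns.tendsto_atTop)
      (Or.inr (ENNReal.ofReal_ne_top (r := L)))
    rw [mul_zero] at this
    refine tendsto_of_tendsto_of_tendsto_of_le_of_le tendsto_const_nhds this
      (fun _ => zero_le) fun n => ?_
    refine eLpNorm_le_mul_eLpNorm_of_ae_le_mul ?_ 2
    filter_upwards [hw] with x hx
    rw [hx]
    exact hLip _ _
  -- `∇(G(φₙ)) - G'(u) g = G'(φₙ) (∇φₙ - g) + (G'(φₙ) - G'(u)) g`: the first term is bounded by
  -- `L |∇φₙ - g|`, the second one tends to zero by dominated convergence along `ns`.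
  · have t1 : Tendsto (fun n => ENNReal.ofReal L *
        eLpNorm (fun x => gradient (φ (ns n)) x - g x) 2 (volume.restrict O)) atTop (𝓝 0) := by
      have := ENNReal.Tendsto.const_mul (h2.comp hns.tendsto_atTop)
        (Or.inr (ENNReal.ofReal_ne_top (r := L)))
      simpa using this
    have m2 : ∀ n, AEStronglyMeasurable
        (fun x => (deriv G (φ (ns n) x) - deriv G (u x)) • g x) (volume.restrict O) := fun n =>
      ((hG'.comp_aestronglyMeasurable (hφ _).memLp.1).sub
        (hG'.comp_aestronglyMeasurable (Lp.memLp u).1)).smul (Lp.memLp g).1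
    have t2 : Tendsto (fun n => eLpNorm
        (fun x => (deriv G (φ (ns n) x) - deriv G (u x)) • g x) 2 (volume.restrict O))
        atTop (𝓝 0) := by
      refine tendsto_eLpNorm_two_of_dominated (bound := fun x => (2 * L) * ‖g x‖) m2
        ((Lp.memLp g).norm.const_mul _) (fun n => Eventually.of_forall fun x => ?_) ?_
      · rw [norm_smul]
        gcongr
        exact (abs_sub _ _).trans (by linarith [hL (φ (ns n) x), hL (u x)])
      · filter_upwards [hae] with x hx
        have := (((hG'.tendsto _).comp hx).sub_const (deriv G (u x))).smul_const (g x)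
        simpa using this
    have t3 := t1.add t2
    rw [add_zero] at t3
    refine tendsto_of_tendsto_of_tendsto_of_le_of_le tendsto_const_nhds t3
      (fun _ => zero_le) fun n => ?_
    have e : eLpNorm (fun x => gradient (fun y => G (φ (ns n) y)) x - h x) 2 (volume.restrict O)
        = eLpNorm ((fun x => deriv G (φ (ns n) x) • (gradient (φ (ns n)) x - g x))
          + fun x => (deriv G (φ (ns n) x) - deriv G (u x)) • g x) 2 (volume.restrict O) := by
      refine eLpNorm_congr_ae ?_
      filter_upwards [hh] with x hx
      rw [hx, gradient_comp (hGd _).hasDerivAt ((hφ _).differentiable x)]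
      simp only [Pi.add_apply, smul_sub, sub_smul]
      abel
    have m1 : AEStronglyMeasurable (fun x => deriv G (φ (ns n) x) • (gradient (φ (ns n)) x - g x))
        (volume.restrict O) :=
      (hG'.comp_aestronglyMeasurable (hφ _).memLp.1).smul ((hφ _).memLp_gradient.1.sub (Lp.memLp g).1)
    rw [e]
    refine (eLpNorm_add_le m1 (m2 n) (by norm_num)).trans ?_
    gcongr
    refine eLpNorm_le_mul_eLpNorm_of_ae_le_mul (Eventually.of_forall fun x => ?_) 2
    rw [norm_smul]
    gcongr
    exact hL _

/-- The chain rule `∇(G(u)) = G'(u) ∇u` for `C¹` functions `G` with bounded derivative. The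
derivative is approximated by smooth functions uniformly on the whole line. -/
theorem HasGradientH10.comp {u : L2 O} {g : L2Vec O} (hu : HasGradientH10 O u g) {G G' : ℝ → ℝ}
    (hG : ∀ s, HasDerivAt G (G' s) s) (hG' : Continuous G') (h0 : G 0 = 0) {L : ℝ}
    (hL : ∀ s, |G' s| ≤ L) {w : L2 O} {h : L2Vec O}
    (hw : ∀ᵐ x ∂volume.restrict O, w x = G (u x))
    (hh : ∀ᵐ x ∂volume.restrict O, h x = G' (u x) • g x) : HasGradientH10 O w h := by
  have hε : ∀ n : ℕ, 0 < 1 / ((n : ℝ) + 1) := fun n => by positivity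
  choose k hk hka _ using fun n : ℕ => hG'.exists_contDiff_approx ⊤
    (continuous_const (y := 1 / ((n : ℝ) + 1))) (fun _ => hε n)
  have hkc : ∀ n, Continuous (k n) := fun n => (hk n).continuous
  let H : ℕ → ℝ → ℝ := fun n s => ∫ t in (0 : ℝ)..s, k n t
  have hHd : ∀ n s, HasDerivAt (H n) (k n s) s := fun n s =>
    (hkc n).integral_hasStrictDerivAt 0 s |>.hasDerivAt
  have hHderiv : ∀ n, deriv (H n) = k n := fun n => funext fun s => (hHd n s).deriv
  have hH0 : ∀ n, H n 0 = 0 := fun n => by simp [H]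
  have hHs : ∀ n, ContDiff ℝ ∞ (H n) := fun n =>
    contDiff_infty_iff_deriv.2 ⟨fun s => (hHd n s).differentiableAt, by
      rw [hHderiv]; exact hk n⟩
  have hd : ∀ n s, |k n s - G' s| ≤ 1 / ((n : ℝ) + 1) := fun n s => (hka n s).le
  have hkL : ∀ n s, |k n s| ≤ L + 1 := fun n s => by
    have h1 := hd n s
    have h2 : 1 / ((n : ℝ) + 1) ≤ 1 := by
      rw [div_le_one (by positivity)]; linarith [Nat.cast_nonneg (α := ℝ) n]
    have h3 := abs_sub_abs_le_abs_sub (k n s) (G' s)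
    linarith [hL s]
  have hLn : 0 ≤ L + 1 := (abs_nonneg _).trans (hkL 0 0)
  have hHle : ∀ n s, |H n s - G s| ≤ 1 / ((n : ℝ) + 1) * |s| := fun n s => by
    have := Convex.norm_image_sub_le_of_norm_hasDerivWithin_le
      (f := fun s => H n s - G s) (f' := fun s => k n s - G' s) (s := Set.univ)
      (C := 1 / ((n : ℝ) + 1)) (fun x _ => ((hHd n x).sub (hG x)).hasDerivWithinAt)
      (fun x _ => by simpa using hd n x) convex_univ (Set.mem_univ 0) (Set.mem_univ s)
    simpa [hH0, h0] using this
  have hHlip : ∀ n, LipschitzWith (Real.toNNReal (L + 1)) (H n) := fun n =>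
    lipschitzWith_of_nnnorm_deriv_le (fun s => (hHd n s).differentiableAt) fun s => by
      rw [hHderiv, ← NNReal.coe_le_coe, Real.coe_toNNReal _ hLn]
      exact hkL n s
  have hm : ∀ n, MemLp (fun x => k n (u x) • g x) 2 (volume.restrict O) := fun n =>
    (Lp.memLp g).of_le_mul (c := L + 1)
      (((hkc n).comp_aestronglyMeasurable (Lp.memLp u).1).smul (Lp.memLp g).1)
      (Eventually.of_forall fun x => by
        rw [norm_smul]; gcongr; exact hkL _ _)
  have lim : Tendsto (fun n : ℕ => 1 / ((n : ℝ) + 1)) atTop (𝓝 0) :=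
    tendsto_one_div_add_atTop_nhds_zero_nat
  refine HasGradientH10.of_tendsto (u := fun n => (hHlip n).compLp (hH0 n) u)
    (g := fun n => (hm n).toLp _) (fun n => ?_) ?_ ?_
  · refine hu.comp_smooth (hHs n) (hH0 n) (L := L + 1) (by rw [hHderiv]; exact hkL n) ?_ ?_
    · exact (hHlip n).coeFn_compLp (hH0 n) u
    · rw [hHderiv]
      exact (hm n).coeFn_toLp
  · rw [tendsto_iff_norm_sub_tendsto_zero]
    refine squeeze_zero (fun _ => norm_nonneg _) (fun n => ?_)
      ((lim.mul_const ‖u‖).mono_right (by rw [zero_mul]))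
    refine Lp.norm_le_mul_norm_of_ae_le_mul ?_
    filter_upwards [(hHlip n).coeFn_compLp (hH0 n) u, hw,
      Lp.coeFn_sub ((hHlip n).compLp (hH0 n) u) w] with x h1 h2 h3
    rw [h3, Pi.sub_apply, h1, h2]
    exact hHle n (u x)
  · rw [tendsto_iff_norm_sub_tendsto_zero]
    refine squeeze_zero (fun _ => norm_nonneg _) (fun n => ?_)
      ((lim.mul_const ‖g‖).mono_right (by rw [zero_mul]))
    refine Lp.norm_le_mul_norm_of_ae_le_mul ?_
    filter_upwards [(hm n).coeFn_toLp, hh, Lp.coeFn_sub ((hm n).toLp _) h] with x h1 h2 h3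
    rw [h3, Pi.sub_apply, h1, h2, ← sub_smul, norm_smul]
    gcongr
    exact hd n (u x)

end ChainRule

/-! ### Yosida approximation of a scalar nonlinearity -/

/-- `β : ℝ → ℝ` is a nondecreasing `C¹` function with derivative `β'` and `β 0 = 0`. -/
structure IsMonotoneC1 (β β' : ℝ → ℝ) : Prop where
  hasDerivAt : ∀ s, HasDerivAt β (β' s) s
  continuous_deriv : Continuous β'
  deriv_nonneg : ∀ s, 0 ≤ β' s
  map_zero : β 0 = 0

/-- The resolvent `(1 + ε β)⁻¹`. -/
noncomputable def scalarRes (β : ℝ → ℝ) (ε : ℝ) : ℝ → ℝ := Function.invFun fun t => t + ε * β t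

namespace IsMonotoneC1

variable {β β' : ℝ → ℝ}

theorem continuous (hβ : IsMonotoneC1 β β') : Continuous β :=
  continuous_iff_continuousAt.2 fun s => (hβ.hasDerivAt s).continuousAt

theorem monotone (hβ : IsMonotoneC1 β β') : Monotone β :=
  monotone_of_deriv_nonneg (fun s => (hβ.hasDerivAt s).differentiableAt) fun s => by
    rw [(hβ.hasDerivAt s).deriv]; exact hβ.deriv_nonneg s

theorem mul_nonneg (hβ : IsMonotoneC1 β β') (a b : ℝ) : 0 ≤ (β a - β b) * (a - b) := by
  rcases le_total a b with h | h
  · exact mul_nonneg_of_nonpos_of_nonpos (by linarith [hβ.monotone h]) (by linarith)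
  · exact _root_.mul_nonneg (by linarith [hβ.monotone h]) (by linarith)

theorem strictMono_add (hβ : IsMonotoneC1 β β') {ε : ℝ} (hε : 0 < ε) : StrictMono fun t => t + ε * β t := fun a b h => by
  have := mul_le_mul_of_nonneg_left (hβ.monotone h.le) hε.le
  simp only
  linarith

theorem surjective_add (hβ : IsMonotoneC1 β β') {ε : ℝ} (hε : 0 < ε) : Function.Surjective fun t => t + ε * β t := by
  have hc : Continuous fun t => t + ε * β t := by have := hβ.continuous; fun_prop
  refine hc.surjective ?_ ?_
  · refine tendsto_atTop_mono' _ ?_ tendsto_id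
    filter_upwards [eventually_ge_atTop 0] with t ht
    have := hβ.monotone ht
    rw [hβ.map_zero] at this
    have := _root_.mul_nonneg hε.le this
    simp only [id]
    linarith
  · refine tendsto_atBot_mono' _ ?_ tendsto_id
    filter_upwards [eventually_le_atBot 0] with t ht
    have := hβ.monotone ht
    rw [hβ.map_zero] at this
    have := mul_nonpos_of_nonneg_of_nonpos hε.le this
    simp only [id]
    linarith

theorem res_add (hβ : IsMonotoneC1 β β') {ε : ℝ} (hε : 0 < ε) (s : ℝ) :
    scalarRes β ε s + ε * β (scalarRes β ε s) = s :=
  Function.rightInverse_invFun (hβ.surjective_add hε) s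

theorem res_comp (hβ : IsMonotoneC1 β β') {ε : ℝ} (hε : 0 < ε) (t : ℝ) : scalarRes β ε (t + ε * β t) = t :=
  Function.leftInverse_invFun (hβ.strictMono_add hε).injective t

theorem res_zero (hβ : IsMonotoneC1 β β') {ε : ℝ} (hε : 0 < ε) : scalarRes β ε 0 = 0 := by
  simpa [hβ.map_zero] using hβ.res_comp hε 0

/-- The two contributions of `a - b` to the decomposition `s = J s + ε β (J s)` have the same sign. -/
theorem abs_res_add_abs (hβ : IsMonotoneC1 β β') {ε : ℝ} (hε : 0 < ε) (a b : ℝ) :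
    |scalarRes β ε a - scalarRes β ε b| + ε * |β (scalarRes β ε a) - β (scalarRes β ε b)|
      = |a - b| := by
  have h1 := hβ.res_add hε a
  have h2 := hβ.res_add hε b
  set x := scalarRes β ε a
  set y := scalarRes β ε b
  have h3 : a - b = (x - y) + ε * (β x - β y) := by rw [← h1, ← h2]; ring
  rcases le_total x y with h | h
  · have h4 := hβ.monotone h
    have h5 : ε * (β x - β y) ≤ 0 := mul_nonpos_of_nonneg_of_nonpos hε.le (by linarith)
    rw [h3, abs_of_nonpos (by linarith), abs_of_nonpos (by linarith : β x - β y ≤ 0),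
      abs_of_nonpos (by linarith)]
    ring
  · have h4 := hβ.monotone h
    have h5 : 0 ≤ ε * (β x - β y) := _root_.mul_nonneg hε.le (by linarith)
    rw [h3, abs_of_nonneg (by linarith), abs_of_nonneg (by linarith : 0 ≤ β x - β y),
      abs_of_nonneg (by linarith)]

theorem abs_res_sub_le (hβ : IsMonotoneC1 β β') {ε : ℝ} (hε : 0 < ε) (a b : ℝ) :
    |scalarRes β ε a - scalarRes β ε b| ≤ |a - b| := by
  have := hβ.abs_res_add_abs hε a b
  have := _root_.mul_nonneg hε.le (abs_nonneg (β (scalarRes β ε a) - β (scalarRes β ε b)))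
  linarith

theorem lipschitzWith_res (hβ : IsMonotoneC1 β β') {ε : ℝ} (hε : 0 < ε) : LipschitzWith 1 (scalarRes β ε) :=
  LipschitzWith.of_dist_le_mul fun a b => by simpa [Real.dist_eq] using hβ.abs_res_sub_le hε a b

theorem lipschitzWith_yosida (hβ : IsMonotoneC1 β β') {ε : ℝ} (hε : 0 < ε) :
    LipschitzWith (Real.toNNReal ε⁻¹) fun s => β (scalarRes β ε s) :=
  LipschitzWith.of_dist_le_mul fun a b => by
    have h1 := hβ.abs_res_add_abs hε a b
    have h2 := abs_nonneg (scalarRes β ε a - scalarRes β ε b)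
    rw [Real.coe_toNNReal _ (by positivity), Real.dist_eq, Real.dist_eq, inv_mul_eq_div,
      le_div_iff₀ hε]
    linarith

theorem yosida_zero (hβ : IsMonotoneC1 β β') {ε : ℝ} (hε : 0 < ε) : β (scalarRes β ε 0) = 0 := by
  rw [hβ.res_zero hε, hβ.map_zero]

theorem hasDerivAt_res (hβ : IsMonotoneC1 β β') {ε : ℝ} (hε : 0 < ε) (s : ℝ) :
    HasDerivAt (scalarRes β ε) (1 + ε * β' (scalarRes β ε s))⁻¹ s := by
  have h := hβ.deriv_nonneg (scalarRes β ε s)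
  refine HasDerivAt.of_local_left_inverse (f := fun t => t + ε * β t)
    (hβ.lipschitzWith_res hε).continuous.continuousAt ?_ (by positivity)
    (Eventually.of_forall (hβ.res_add hε))
  exact (hasDerivAt_id _).add ((hβ.hasDerivAt _).const_mul ε)

theorem hasDerivAt_yosida (hβ : IsMonotoneC1 β β') {ε : ℝ} (hε : 0 < ε) (s : ℝ) :
    HasDerivAt (fun s => β (scalarRes β ε s))
      (β' (scalarRes β ε s) * (1 + ε * β' (scalarRes β ε s))⁻¹) s :=
  (hβ.hasDerivAt _).comp s (hβ.hasDerivAt_res hε s)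

theorem continuous_inv_one_add (hβ : IsMonotoneC1 β β') {ε : ℝ} (hε : 0 < ε) :
    Continuous fun s => (1 + ε * β' (scalarRes β ε s))⁻¹ := by
  have h1 := (hβ.lipschitzWith_res hε).continuous
  have h2 := hβ.continuous_deriv
  refine Continuous.inv₀ (by fun_prop) fun s => ?_
  have h := hβ.deriv_nonneg (scalarRes β ε s)
  positivity

theorem continuous_yosida_deriv (hβ : IsMonotoneC1 β β') {ε : ℝ} (hε : 0 < ε) :
    Continuous fun s => β' (scalarRes β ε s) * (1 + ε * β' (scalarRes β ε s))⁻¹ :=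
  (hβ.continuous_deriv.comp (hβ.lipschitzWith_res hε).continuous).mul (hβ.continuous_inv_one_add hε)

theorem yosida_deriv_nonneg (hβ : IsMonotoneC1 β β') {ε : ℝ} (hε : 0 < ε) (s : ℝ) :
    0 ≤ β' (scalarRes β ε s) * (1 + ε * β' (scalarRes β ε s))⁻¹ := by
  have h := hβ.deriv_nonneg (scalarRes β ε s)
  positivity

theorem abs_yosida_deriv_le (hβ : IsMonotoneC1 β β') {ε : ℝ} (hε : 0 < ε) (s : ℝ) :
    |β' (scalarRes β ε s) * (1 + ε * β' (scalarRes β ε s))⁻¹| ≤ ε⁻¹ := by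
  rw [abs_of_nonneg (hβ.yosida_deriv_nonneg hε s)]
  have h := hβ.deriv_nonneg (scalarRes β ε s)
  rw [← div_eq_mul_inv, ← one_div, div_le_div_iff₀ (by positivity) hε]
  linarith

theorem abs_apply_res_le (hβ : IsMonotoneC1 β β') {ε : ℝ} (hε : 0 < ε) (s : ℝ) : |β (scalarRes β ε s)| ≤ |β s| := by
  have h1 := hβ.res_add hε s
  have h0 := hβ.map_zero
  rcases le_total 0 (scalarRes β ε s) with h | h
  · have h2 := hβ.monotone h
    rw [h0] at h2
    have h3 := _root_.mul_nonneg hε.le h2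
    have h4 := hβ.monotone (show scalarRes β ε s ≤ s by linarith)
    rwa [abs_of_nonneg h2, abs_of_nonneg (h2.trans h4)]
  · have h2 := hβ.monotone h
    rw [h0] at h2
    have h3 := mul_nonpos_of_nonneg_of_nonpos hε.le h2
    have h4 := hβ.monotone (show s ≤ scalarRes β ε s by linarith)
    rw [abs_of_nonpos h2, abs_of_nonpos (h4.trans h2)]
    linarith

theorem yosida_mul_nonneg (hβ : IsMonotoneC1 β β') {ε : ℝ} (hε : 0 < ε) (s : ℝ) : 0 ≤ β (scalarRes β ε s) * s := by
  have h1 := hβ.res_add hε s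
  have h2 := hβ.mul_nonneg (scalarRes β ε s) 0
  rw [hβ.map_zero, sub_zero, sub_zero] at h2
  have : β (scalarRes β ε s) * s = β (scalarRes β ε s) * scalarRes β ε s
      + ε * β (scalarRes β ε s) ^ 2 := by
    linear_combination (-β (scalarRes β ε s)) * h1
  rw [this]
  positivity

/-- Two Yosida approximations of `β` are jointly monotone up to an error that vanishes with the
parameters. -/
theorem yosida_sub_mul_sub_ge (hβ : IsMonotoneC1 β β') {ε δ : ℝ} (hε : 0 < ε) (hδ : 0 < δ) (a b : ℝ) :
    -((ε + δ) * (β (scalarRes β ε a) * β (scalarRes β δ b)))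
      ≤ (β (scalarRes β ε a) - β (scalarRes β δ b)) * (a - b) := by
  have h1 := hβ.res_add hε a
  have h2 := hβ.res_add hδ b
  have h3 := hβ.mul_nonneg (scalarRes β ε a) (scalarRes β δ b)
  set x := scalarRes β ε a
  set y := scalarRes β δ b
  rw [← h1, ← h2]
  nlinarith [_root_.mul_nonneg hε.le (sq_nonneg (β x)), _root_.mul_nonneg hδ.le (sq_nonneg (β y))]

theorem abs_sub_res_le (hβ : IsMonotoneC1 β β') {ε : ℝ} (hε : 0 < ε) (s : ℝ) :
    |s - scalarRes β ε s| ≤ ε * |β (scalarRes β ε s)| := by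
  have h1 := hβ.res_add hε s
  have : s - scalarRes β ε s = ε * β (scalarRes β ε s) := by linarith
  rw [this, abs_mul, abs_of_pos hε]

theorem tendsto_res (hβ : IsMonotoneC1 β β') {ε : ℕ → ℝ} (hε : ∀ n, 0 < ε n) (h0 : Tendsto ε atTop (𝓝 0)) (s : ℝ) :
    Tendsto (fun n => scalarRes β (ε n) s) atTop (𝓝 s) := by
  rw [tendsto_iff_norm_sub_tendsto_zero]
  refine squeeze_zero (fun _ => norm_nonneg _) (fun n => ?_)
    ((h0.mul_const |β s|).mono_right (by rw [zero_mul]))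
  rw [norm_sub_rev]
  exact (hβ.abs_sub_res_le (hε n) s).trans
    (mul_le_mul_of_nonneg_left (hβ.abs_apply_res_le (hε n) s) (hε n).le)

end IsMonotoneC1

/-! ### Semilinear equations with a monotone nonlinearity -/

section L2Lemmas

variable {α : Type*} [MeasurableSpace α] {μ : Measure α}

/-- Fatou's lemma for `L^p` norms with a uniform bound. -/
theorem eLpNorm_le_of_ae_tendsto {E : Type*} [NormedAddCommGroup E] {p B : ℝ≥0∞}
    {f : ℕ → α → E} {g : α → E} (hf : ∀ n, AEStronglyMeasurable (f n) μ)
    (h : ∀ᵐ x ∂μ, Tendsto (fun n => f n x) atTop (𝓝 (g x))) (hB : ∀ n, eLpNorm (f n) p μ ≤ B) :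
    eLpNorm g p μ ≤ B :=
  (Lp.eLpNorm_lim_le_liminf_eLpNorm hf g h).trans
    ((liminf_le_liminf (Eventually.of_forall hB)).trans_eq (liminf_const B))

theorem L2_inner_eq (a b : Lp ℝ 2 μ) : inner ℝ a b = ∫ x, a x * b x ∂μ := by
  rw [L2.inner_def]
  exact integral_congr_ae (Eventually.of_forall fun x => by simp [mul_comm])

theorem L2_integrable_mul (a b : Lp ℝ 2 μ) : Integrable (fun x => a x * b x) μ :=
  (Lp.memLp a).integrable_mul (Lp.memLp b)

theorem L2_inner_le_inner {a b c e : Lp ℝ 2 μ} (h : ∀ᵐ x ∂μ, a x * b x ≤ c x * e x) :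
    inner ℝ a b ≤ (inner ℝ c e : ℝ) := by
  rw [L2_inner_eq, L2_inner_eq]
  exact integral_mono_ae (L2_integrable_mul a b) (L2_integrable_mul c e) h

theorem L2_inner_nonneg {a b : Lp ℝ 2 μ} (h : ∀ᵐ x ∂μ, 0 ≤ a x * b x) :
    0 ≤ (inner ℝ a b : ℝ) := by
  rw [L2_inner_eq]
  exact integral_nonneg_of_ae h

theorem L2_abs_inner_le {a b c e : Lp ℝ 2 μ} (h : ∀ᵐ x ∂μ, |a x * b x| ≤ c x * e x) :
    |(inner ℝ a b : ℝ)| ≤ ‖c‖ * ‖e‖ := by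
  refine le_trans ?_ (real_inner_le_norm c e)
  rw [L2_inner_eq, L2_inner_eq]
  refine (abs_integral_le_integral_abs).trans ?_
  exact integral_mono_ae (L2_integrable_mul a b).abs (L2_integrable_mul c e) h

end L2Lemmas

section Laplacian

variable {d : ℕ} {O : Set (Eu d)}

theorem IsNegLaplacian.norm_sub_sq (hO : IsOpen O) {u v : H10 O} {f g : L2 O}
    (hu : IsNegLaplacian u f) (hv : IsNegLaplacian v g) :
    ‖gradH10 u - gradH10 v‖ ^ 2 = inner ℝ (f - g) ((u : L2 O) - (v : L2 O)) := by
  have h := (gradH10_spec u).sub (gradH10_spec v)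
  have h1 := hu ⟨_, h.mem⟩
  have h2 := hv ⟨_, h.mem⟩
  rw [h.gradH10_eq hO] at h1 h2
  rw [← real_inner_self_eq_norm_sq, inner_sub_left, inner_sub_left, h1, h2]

theorem IsNegLaplacian.inner_sub_nonneg (hO : IsOpen O) {u v : H10 O} {f g : L2 O}
    (hu : IsNegLaplacian u f) (hv : IsNegLaplacian v g) :
    0 ≤ (inner ℝ (f - g) ((u : L2 O) - (v : L2 O)) : ℝ) := by
  rw [← hu.norm_sub_sq hO hv]; positivity

/-- The Dirichlet Laplacian is closed from the strong topology to the topology of weak convergence: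
bounded right-hand sides make the gradients a Cauchy sequence. -/
theorem IsNegLaplacian.of_tendsto (hO : IsOpen O) {u : ℕ → H10 O} {f : ℕ → L2 O} {u₀ f₀ : L2 O}
    (h : ∀ n, IsNegLaplacian (u n) (f n)) {M : ℝ} (hM : ∀ n, ‖f n‖ ≤ M)
    (hu : Tendsto (fun n => (u n : L2 O)) atTop (𝓝 u₀))
    (hf : ∀ (φ : Eu d → ℝ) (hφ : IsTestFunction O φ), Tendsto
      (fun n => (inner ℝ (f n) (hφ.memLp.toLp φ) : ℝ)) atTop (𝓝 (inner ℝ f₀ (hφ.memLp.toLp φ)))) :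
    ∃ h₀ : u₀ ∈ H10 O, IsNegLaplacian ⟨u₀, h₀⟩ f₀ := by
  have hM0 : 0 ≤ M := (norm_nonneg _).trans (hM 0)
  have hb : ∀ m n, ‖gradH10 (u m) - gradH10 (u n)‖ ^ 2 ≤ 2 * M * dist (u m : L2 O) (u n) := by
    intro m n
    rw [(h m).norm_sub_sq hO (h n), dist_eq_norm]
    refine (real_inner_le_norm _ _).trans ?_
    gcongr
    exact (norm_sub_le _ _).trans (by linarith [hM m, hM n])
  have hc : CauchySeq fun n => gradH10 (u n) := by
    rw [Metric.cauchySeq_iff]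
    intro ε hε
    obtain ⟨N, hN⟩ := Metric.cauchySeq_iff.1 hu.cauchySeq (ε ^ 2 / (2 * M + 1)) (by positivity)
    refine ⟨N, fun m hm n hn => ?_⟩
    rw [dist_eq_norm]
    refine lt_of_pow_lt_pow_left₀ 2 hε.le ?_
    have h1 := hN m hm n hn
    rw [lt_div_iff₀ (by positivity)] at h1
    have h2 := hb m n
    have h3 : 0 ≤ dist (u m : L2 O) (u n) := dist_nonneg
    nlinarith
  obtain ⟨g, hg⟩ := cauchySeq_tendsto_of_complete hc
  have hgr : HasGradientH10 O u₀ g := .of_tendsto (fun n => gradH10_spec (u n)) hu hg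
  refine ⟨hgr.mem, fun v => ?_⟩
  rw [hgr.gradH10_eq hO]
  refine forall_gradGraph_of_test (fun φ hφ => ?_) (gradH10_spec v)
  refine tendsto_nhds_unique (hg.inner (𝕜 := ℝ) tendsto_const_nhds) ((hf φ hφ).congr fun n => ?_)
  have := h n ⟨_, hφ.mem_H10.mem⟩
  rw [hφ.mem_H10.gradH10_eq hO] at this
  exact this.symm

/-- Testing `-Δu = f` with `G(u)`. -/
theorem IsNegLaplacian.inner_comp (hO : IsOpen O) {u : H10 O} {f : L2 O} (h : IsNegLaplacian u f)
    {G G' : ℝ → ℝ} (hG : ∀ s, HasDerivAt G (G' s) s) (hG' : Continuous G') (h0 : G 0 = 0) {L : ℝ}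
    (hL : ∀ s, |G' s| ≤ L) {w : L2 O} (hw : ∀ᵐ x ∂volume.restrict O, w x = G ((u : L2 O) x)) :
    inner ℝ f w = ∫ x in O, G' ((u : L2 O) x) * ‖gradH10 u x‖ ^ 2 := by
  have hm : MemLp (fun x => G' ((u : L2 O) x) • gradH10 u x) 2 (volume.restrict O) :=
    (Lp.memLp (gradH10 u)).of_le_mul (c := L)
      ((hG'.comp_aestronglyMeasurable (Lp.memLp _).1).smul (Lp.memLp _).1)
      (Eventually.of_forall fun x => by
        rw [norm_smul]; gcongr; exact hL _)
  have hg := (gradH10_spec u).comp hG hG' h0 hL hw hm.coeFn_toLp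
  have := h ⟨w, hg.mem⟩
  rw [hg.gradH10_eq hO] at this
  rw [← this, L2.inner_def]
  refine integral_congr_ae ?_
  filter_upwards [hm.coeFn_toLp] with x hx
  rw [hx, inner_smul_right, real_inner_self_eq_norm_sq]

end Laplacian

section Existence

variable {d : ℕ} {O : Set (Eu d)} {β β' : ℝ → ℝ}

/-- The superposition operator of `(1 + ε β)⁻¹` on `L²(O)`. -/
noncomputable def IsMonotoneC1.resL2 (hβ : IsMonotoneC1 β β') {ε : ℝ} (hε : 0 < ε) (u : L2 O) :
    L2 O := (hβ.lipschitzWith_res hε).compLp (hβ.res_zero hε) u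

/-- The superposition operator of the Yosida approximation `β ∘ (1 + ε β)⁻¹` on `L²(O)`. -/
noncomputable def IsMonotoneC1.yosidaL2 (hβ : IsMonotoneC1 β β') {ε : ℝ} (hε : 0 < ε) (u : L2 O) :
    L2 O := (hβ.lipschitzWith_yosida hε).compLp (hβ.yosida_zero hε) u

theorem IsMonotoneC1.coeFn_resL2 (hβ : IsMonotoneC1 β β') {ε : ℝ} (hε : 0 < ε) (u : L2 O) :
    ∀ᵐ x ∂volume.restrict O, hβ.resL2 hε u x = scalarRes β ε (u x) :=
  (hβ.lipschitzWith_res hε).coeFn_compLp (hβ.res_zero hε) u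

theorem IsMonotoneC1.coeFn_yosidaL2 (hβ : IsMonotoneC1 β β') {ε : ℝ} (hε : 0 < ε) (u : L2 O) :
    ∀ᵐ x ∂volume.restrict O, hβ.yosidaL2 hε u x = β (scalarRes β ε (u x)) :=
  (hβ.lipschitzWith_yosida hε).coeFn_compLp (hβ.yosida_zero hε) u

theorem IsMonotoneC1.resL2_add_yosidaL2 (hβ : IsMonotoneC1 β β') {ε : ℝ} (hε : 0 < ε) (u : L2 O) :
    hβ.resL2 hε u + ε • hβ.yosidaL2 hε u = u := by
  refine Lp.ext ?_
  filter_upwards [hβ.coeFn_resL2 hε u, hβ.coeFn_yosidaL2 hε u,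
    Lp.coeFn_add (hβ.resL2 hε u) (ε • hβ.yosidaL2 hε u),
    Lp.coeFn_smul ε (hβ.yosidaL2 hε u)] with x h1 h2 h3 h4
  rw [h3, Pi.add_apply, h4, Pi.smul_apply, h1, h2, smul_eq_mul, hβ.res_add hε]

theorem IsMonotoneC1.inner_yosidaL2_nonneg (hβ : IsMonotoneC1 β β') {ε : ℝ} (hε : 0 < ε)
    (u : L2 O) : 0 ≤ (inner ℝ u (hβ.yosidaL2 hε u) : ℝ) := by
  refine L2_inner_nonneg ?_
  filter_upwards [hβ.coeFn_yosidaL2 hε u] with x hx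
  rw [hx, mul_comm]
  exact hβ.yosida_mul_nonneg hε _

/-- The Yosida-regularized equation is solved by Banach's fixed point theorem: it reads
`-Δu + (μ + ε⁻¹) u = f + ε⁻¹ (1 + ε β)⁻¹ u`, and the resolvent of `β` is nonexpansive. -/
theorem IsMonotoneC1.exists_yosida_solution (hβ : IsMonotoneC1 β β') (hO : IsOpen O) {ε : ℝ}
    (hε : 0 < ε) {μ : ℝ} (hμ : 0 < μ) (f : L2 O) :
    ∃ u : H10 O, IsNegLaplacian u (f - hβ.yosidaL2 hε (u : L2 O) - μ • (u : L2 O)) := by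
  have hε' : 0 < ε⁻¹ := inv_pos.2 hε
  have hκ : 0 < μ + ε⁻¹ := by positivity
  choose R hR using exists_isNegLaplacian_sub_smul hO hκ
  have hRl : ∀ x y, ‖(R x : L2 O) - R y‖ ≤ (μ + ε⁻¹)⁻¹ * ‖x - y‖ := by
    intro x y
    have h1 := (hR x).inner_sub_nonneg hO (hR y)
    have h2 : x - (μ + ε⁻¹) • (R x : L2 O) - (y - (μ + ε⁻¹) • (R y : L2 O))
        = (x - y) - (μ + ε⁻¹) • ((R x : L2 O) - R y) := by rw [smul_sub]; abel
    rw [h2, inner_sub_left, inner_smul_left, real_inner_self_eq_norm_sq, RCLike.conj_to_real] at h1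
    have h3 := real_inner_le_norm (x - y) ((R x : L2 O) - R y)
    rw [inv_mul_eq_div, le_div_iff₀ hκ]
    rcases (norm_nonneg ((R x : L2 O) - R y)).eq_or_lt with h | h
    · rw [← h]; simp
    · refine le_of_mul_le_mul_right ?_ h
      nlinarith
  let T : L2 O → L2 O := fun u => R (f + ε⁻¹ • hβ.resL2 hε u)
  -- The Lipschitz constant is `ε⁻¹ / (μ + ε⁻¹) < 1`.
  have hT : ContractingWith (Real.toNNReal ((μ + ε⁻¹)⁻¹ * ε⁻¹)) T := by
    refine ⟨?_, LipschitzWith.of_dist_le_mul fun u v => ?_⟩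
    · rw [← NNReal.coe_lt_coe, Real.coe_toNNReal _ (by positivity), inv_mul_eq_div, NNReal.coe_one,
        div_lt_one hκ]
      linarith
    · rw [Real.coe_toNNReal _ (by positivity), dist_eq_norm, dist_eq_norm]
      refine (hRl _ _).trans ?_
      rw [add_sub_add_left_eq_sub, ← smul_sub, norm_smul, Real.norm_of_nonneg hε'.le, ← mul_assoc]
      gcongr
      exact ((hβ.lipschitzWith_res hε).norm_compLp_sub_le (hβ.res_zero hε) u v).trans_eq
        (by rw [NNReal.coe_one, one_mul])
  have hfix : T (hT.fixedPoint T) = hT.fixedPoint T := hT.fixedPoint_isFixedPt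
  set u := hT.fixedPoint T
  refine ⟨R (f + ε⁻¹ • hβ.resL2 hε u), ?_⟩
  have h1 := hR (f + ε⁻¹ • hβ.resL2 hε u)
  have h2 : ((R (f + ε⁻¹ • hβ.resL2 hε u) : H10 O) : L2 O) = u := hfix
  convert h1 using 1
  rw [h2]
  have h3 := hβ.resL2_add_yosidaL2 hε u
  have h4 : ε⁻¹ • u = ε⁻¹ • hβ.resL2 hε u + hβ.yosidaL2 hε u := by
    conv_lhs => rw [← h3]
    rw [smul_add, smul_smul, inv_mul_cancel₀ hε.ne', one_smul]
  rw [add_smul, h4]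
  abel

/-- For a nondecreasing nonlinearity `β` whose increments are controlled by
`|β a - β b| ≤ C (1 + |β a| + |β b|) |a - b|`, the equation `-Δu + β(u) + μ u = f` has a solution
with `β(u) ∈ L²(O)`. The solutions `uₙ` of the Yosida-regularized equations have regularized
nonlinear terms bounded by `‖f‖` (test with the nonlinear term), hence converge in `L²(O)`, and the
growth condition identifies the weak limit of the nonlinear terms. -/
theorem IsMonotoneC1.exists_solution (hβ : IsMonotoneC1 β β') (hO : IsOpen O) {C : ℝ}
    (hC : 0 ≤ C) (hgrow : ∀ a b, |β a - β b| ≤ C * (1 + |β a| + |β b|) * |a - b|) {μ : ℝ}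
    (hμ : 0 < μ) (f : L2 O) :
    ∃ (u : H10 O) (b : L2 O), (∀ᵐ x ∂volume.restrict O, b x = β ((u : L2 O) x)) ∧
      IsNegLaplacian u (f - b - μ • (u : L2 O)) := by
  let ε : ℕ → ℝ := fun n => 1 / ((n : ℝ) + 1)
  have hε : ∀ n, 0 < ε n := fun n => by positivity
  have hε0 : Tendsto ε atTop (𝓝 0) := tendsto_one_div_add_atTop_nhds_zero_nat
  have hεanti : ∀ {m n : ℕ}, m ≤ n → ε n ≤ ε m := fun {m n} h => by
    simp only [ε]; gcongr
  choose u hu using fun n => hβ.exists_yosida_solution hO (hε n) hμ f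
  set y : ℕ → L2 O := fun n => hβ.yosidaL2 (hε n) (u n : L2 O) with hy
  set j : ℕ → L2 O := fun n => hβ.resL2 (hε n) (u n : L2 O) with hj
  -- Testing with `y n` itself: the Laplacian contributes a nonnegative term by the chain rule.
  have hyn : ∀ n, ‖y n‖ ≤ ‖f‖ := by
    intro n
    have h1 := (hu n).inner_comp hO (hβ.hasDerivAt_yosida (hε n)) (hβ.continuous_yosida_deriv (hε n))
      (hβ.yosida_zero (hε n)) (hβ.abs_yosida_deriv_le (hε n)) (hβ.coeFn_yosidaL2 (hε n) _)
    have h2 : 0 ≤ (inner ℝ (f - y n - μ • (u n : L2 O)) (y n) : ℝ) := by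
      rw [h1]
      exact integral_nonneg fun x =>
        _root_.mul_nonneg (hβ.yosida_deriv_nonneg (hε n) _) (by positivity)
    have h3 := hβ.inner_yosidaL2_nonneg (hε n) (u n : L2 O)
    rw [inner_sub_left, inner_sub_left, inner_smul_left, real_inner_self_eq_norm_sq,
      RCLike.conj_to_real] at h2
    have h4 := real_inner_le_norm f (y n)
    have h5 := _root_.mul_nonneg hμ.le h3
    rcases (norm_nonneg (y n)).eq_or_lt with h | h
    · rw [← h]; positivity
    · refine le_of_mul_le_mul_right ?_ h
      simp only [hy] at *
      nlinarith
  -- Subtracting two equations; the defect of joint monotonicity is at most `(ε n + ε m) ‖f‖²`.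
  have hcau : ∀ n m, μ * ‖(u n : L2 O) - u m‖ ^ 2 ≤ (ε n + ε m) * ‖f‖ ^ 2 := by
    intro n m
    have h1 := (hu n).inner_sub_nonneg hO (hu m)
    have h2 : f - y n - μ • (u n : L2 O) - (f - y m - μ • (u m : L2 O))
        = -(y n - y m) - μ • ((u n : L2 O) - u m) := by rw [smul_sub]; abel
    simp only [hy] at h2
    rw [h2, inner_sub_left, inner_smul_left, real_inner_self_eq_norm_sq, RCLike.conj_to_real,
      inner_neg_left] at h1
    have h3 : inner ℝ (-((ε n + ε m) • y n)) (y m)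
        ≤ (inner ℝ (y n - y m) ((u n : L2 O) - u m) : ℝ) := by
      refine L2_inner_le_inner ?_
      filter_upwards [hβ.coeFn_yosidaL2 (hε n) (u n : L2 O), hβ.coeFn_yosidaL2 (hε m) (u m : L2 O),
        Lp.coeFn_neg ((ε n + ε m) • y n), Lp.coeFn_smul (ε n + ε m) (y n),
        Lp.coeFn_sub (y n) (y m), Lp.coeFn_sub (u n : L2 O) (u m)] with x h1 h2 h3 h4 h5 h6
      rw [h3, Pi.neg_apply, h4, Pi.smul_apply, h5, h6, Pi.sub_apply, Pi.sub_apply, smul_eq_mul]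
      simp only [hy]
      rw [h1, h2]
      have := hβ.yosida_sub_mul_sub_ge (hε n) (hε m) ((u n : L2 O) x) ((u m : L2 O) x)
      linarith
    rw [inner_neg_left, inner_smul_left, RCLike.conj_to_real] at h3
    have h4 := real_inner_le_norm (y n) (y m)
    have h5 : ‖y n‖ * ‖y m‖ ≤ ‖f‖ ^ 2 := by
      rw [sq]; exact mul_le_mul (hyn n) (hyn m) (norm_nonneg _) (norm_nonneg _)
    have h6 : (ε n + ε m) * inner ℝ (y n) (y m) ≤ (ε n + ε m) * ‖f‖ ^ 2 :=
      mul_le_mul_of_nonneg_left (h4.trans h5) (add_pos (hε n) (hε m)).le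
    simp only [hy] at *
    linarith
  have hcs : CauchySeq fun n => (u n : L2 O) := by
    refine cauchySeq_of_le_tendsto_0 (fun N => Real.sqrt (2 * ε N * ‖f‖ ^ 2 / μ)) ?_ ?_
    · intro n m N hn hm
      rw [dist_eq_norm]
      refine Real.le_sqrt_of_sq_le ?_
      rw [le_div_iff₀ hμ, mul_comm]
      refine (hcau n m).trans ?_
      gcongr
      linarith [hεanti hn, hεanti hm]
    · have := ((hε0.const_mul 2).mul_const (‖f‖ ^ 2)).div_const μ
      simpa using this.sqrt
  obtain ⟨U, hU⟩ := cauchySeq_tendsto_of_complete hcs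
  have hjU : Tendsto j atTop (𝓝 U) := by
    have h1 : ∀ n, j n = (u n : L2 O) - ε n • y n := fun n =>
      eq_sub_of_add_eq (hβ.resL2_add_yosidaL2 (hε n) (u n : L2 O))
    have h2 : Tendsto (fun n => ε n • y n) atTop (𝓝 0) := by
      refine squeeze_zero_norm (a := fun n => ε n * ‖f‖) (fun n => ?_)
        ((hε0.mul_const ‖f‖).mono_right (by rw [zero_mul]))
      rw [norm_smul, Real.norm_of_nonneg (hε n).le]
      exact mul_le_mul_of_nonneg_left (hyn n) (hε n).le
    have := hU.sub h2
    rw [sub_zero] at this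
    exact this.congr fun n => (h1 n).symm
  have hyj : ∀ n, ∀ᵐ x ∂volume.restrict O, y n x = β (j n x) := fun n => by
    filter_upwards [hβ.coeFn_yosidaL2 (hε n) (u n : L2 O), hβ.coeFn_resL2 (hε n) (u n : L2 O)]
      with x h1 h2
    simp only [hy, hj]
    rw [h1, h2]
  have hbm : MemLp (fun x => β (U x)) 2 (volume.restrict O) := by
    obtain ⟨ns, hns, hae⟩ := (tendstoInMeasure_of_tendsto_Lp hjU).exists_seq_tendsto_ae
    refine ⟨hβ.continuous.comp_aestronglyMeasurable (Lp.memLp U).1, ?_⟩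
    refine lt_of_le_of_lt (eLpNorm_le_of_ae_tendsto (f := fun n x => y (ns n) x)
      (fun n => (Lp.memLp (y (ns n))).1) ?_ fun n => ?_) (ENNReal.ofReal_lt_top (r := ‖f‖))
    · filter_upwards [hae, ae_all_iff.2 hyj] with x hx hx'
      simp only [hx']
      exact (hβ.continuous.tendsto _).comp hx
    · rw [← ENNReal.ofReal_toReal (Lp.eLpNorm_ne_top (y (ns n)))]
      exact ENNReal.ofReal_le_ofReal (hyn _)
  set b : L2 O := hbm.toLp _ with hb
  have hbc : ∀ᵐ x ∂volume.restrict O, b x = β (U x) := hbm.coeFn_toLp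
  -- For bounded `φ` the growth condition bounds `(y n - b) φ` pointwise by `|j n - U|` times a function
  -- that is bounded in `L²`.
  have hweak : ∀ (φ : Eu d → ℝ) (hφ : IsTestFunction O φ),
      Tendsto (fun n => (inner ℝ (y n) (hφ.memLp.toLp φ) : ℝ)) atTop
        (𝓝 (inner ℝ b (hφ.memLp.toLp φ))) := by
    intro φ hφ
    obtain ⟨M, hM⟩ := hφ.2.1.exists_bound_of_continuous hφ.1.continuous
    have hM0 : 0 ≤ M := (norm_nonneg _).trans (hM 0)
    set ψ : L2 O := hφ.memLp.toLp φ with hψ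
    have hψc : ∀ᵐ x ∂volume.restrict O, ψ x = φ x := hφ.memLp.coeFn_toLp
    have key : ∀ n, |(inner ℝ (y n) ψ : ℝ) - inner ℝ b ψ|
        ≤ C * (‖ψ‖ + M * ‖f‖ + M * ‖b‖) * ‖j n - U‖ := by
      intro n
      have h1 : |(inner ℝ (y n - b) ψ : ℝ)|
          ≤ ‖C • (|ψ| + M • |y n| + M • |b|)‖ * ‖|j n - U|‖ := by
        refine L2_abs_inner_le ?_
        filter_upwards [hyj n, hbc, hψc, Lp.coeFn_sub (y n) b, Lp.coeFn_sub (j n) U,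
          Lp.coeFn_abs (j n - U), Lp.coeFn_smul C (|ψ| + M • |y n| + M • |b|),
          Lp.coeFn_add (|ψ| + M • |y n|) (M • |b|), Lp.coeFn_add |ψ| (M • |y n|),
          Lp.coeFn_smul M |y n|, Lp.coeFn_smul M |b|, Lp.coeFn_abs ψ, Lp.coeFn_abs (y n),
          Lp.coeFn_abs b] with x e1 e2 e3 e4 e5 e6 e7 e8 e9 e10 e11 e12 e13 e14
        rw [e4, e6, e7, Pi.sub_apply, e5, Pi.smul_apply, e8, Pi.add_apply, e9, Pi.add_apply, e10,
          e11, Pi.smul_apply, Pi.smul_apply, e12, e13, e14, Pi.sub_apply, e3, e1, e2]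
        simp only [smul_eq_mul]
        rw [abs_mul]
        have hφx : |φ x| ≤ M := hM x
        have hg := mul_le_mul_of_nonneg_right (hgrow (j n x) (U x)) (abs_nonneg (φ x))
        refine hg.trans ?_
        have i1 : |β (j n x)| * |φ x| ≤ M * |β (j n x)| := by
          rw [mul_comm]; gcongr
        have i2 : |β (U x)| * |φ x| ≤ M * |β (U x)| := by
          rw [mul_comm]; gcongr
        have i3 : C * (1 + |β (j n x)| + |β (U x)|) * |j n x - U x| * |φ x|
            = C * (|φ x| + |β (j n x)| * |φ x| + |β (U x)| * |φ x|) * |j n x - U x| := by ring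
        rw [i3]
        gcongr
      rw [← inner_sub_left]
      refine h1.trans ?_
      rw [norm_smul, Real.norm_of_nonneg hC, norm_abs_eq_norm]
      gcongr
      refine (norm_add_le _ _).trans (add_le_add ((norm_add_le _ _).trans (add_le_add ?_ ?_)) ?_)
      · rw [norm_abs_eq_norm]
      · rw [norm_smul, Real.norm_of_nonneg hM0, norm_abs_eq_norm]
        gcongr
        exact hyn n
      · rw [norm_smul, Real.norm_of_nonneg hM0, norm_abs_eq_norm]
    rw [tendsto_iff_norm_sub_tendsto_zero]
    refine squeeze_zero (fun _ => norm_nonneg _) key ?_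
    have := (tendsto_iff_norm_sub_tendsto_zero.1 hjU).const_mul (C * (‖ψ‖ + M * ‖f‖ + M * ‖b‖))
    rwa [mul_zero] at this
  obtain ⟨B, hB⟩ := hU.norm.bddAbove_range
  obtain ⟨h₀, hL⟩ := IsNegLaplacian.of_tendsto hO hu (M := ‖f‖ + ‖f‖ + μ * B) (u₀ := U)
    (f₀ := f - b - μ • U) (fun n => by
      refine (norm_sub_le _ _).trans (add_le_add ((norm_sub_le _ _).trans
        (add_le_add le_rfl (hyn n))) ?_)
      rw [norm_smul, Real.norm_of_nonneg hμ.le]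
      exact mul_le_mul_of_nonneg_left (hB ⟨n, rfl⟩) hμ.le) hU (fun φ hφ => by
      simp only [inner_sub_left, inner_smul_left]
      exact (tendsto_const_nhds.sub (hweak φ hφ)).sub
        ((hU.inner (𝕜 := ℝ) tendsto_const_nhds).const_mul _))
  exact ⟨⟨U, h₀⟩, b, hbc, hL⟩

end Existence

/-! ### The Sobolev embedding of `H¹₀(O)` -/

section Sobolev

/-- Interpolation between `L²` and `L^s`, with a gradient norm `D` controlling both. -/
theorem lintegral_rpow_le_of_interpolation {α : Type*} [MeasurableSpace α] {μ : Measure α}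
    {f : α → ℝ≥0∞} (hf : AEMeasurable f μ) {r s : ℝ} (hr : 2 ≤ r) (hrs : r ≤ s) (hs : 2 < s)
    {c K D : ℝ≥0∞} (h2 : ∫⁻ x, f x ^ (2 : ℝ) ∂μ ≤ c * D)
    (h3 : ∫⁻ x, f x ^ s ∂μ ≤ K * D ^ (s / 2)) :
    ∫⁻ x, f x ^ r ∂μ ≤ c ^ ((s - r) / (s - 2)) * K ^ ((r - 2) / (s - 2)) * D ^ (r / 2) := by
  have hs0 : 0 < s - 2 := by linarith
  set a := (s - r) / (s - 2) with ha
  set b := (r - 2) / (s - 2) with hb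
  have ha0 : 0 ≤ a := div_nonneg (by linarith) hs0.le
  have hb0 : 0 ≤ b := div_nonneg (by linarith) hs0.le
  have hab : a + b = 1 := by rw [ha, hb]; field_simp; ring
  have hr2 : 2 * a + s * b = r := by rw [ha, hb]; field_simp; ring
  calc ∫⁻ x, f x ^ r ∂μ = ∫⁻ x, (f x ^ (2 : ℝ)) ^ a * (f x ^ s) ^ b ∂μ := by
        refine lintegral_congr fun x => ?_
        rw [← ENNReal.rpow_mul, ← ENNReal.rpow_mul, ← ENNReal.rpow_add_of_nonneg _ _ (by positivity)
          (mul_nonneg (by linarith) hb0), hr2]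
    _ ≤ (∫⁻ x, f x ^ (2 : ℝ) ∂μ) ^ a * (∫⁻ x, f x ^ s ∂μ) ^ b :=
        ENNReal.lintegral_mul_norm_pow_le (hf.pow_const _) (hf.pow_const _) ha0 hb0 hab
    _ ≤ (c * D) ^ a * (K * D ^ (s / 2)) ^ b := by gcongr
    _ = c ^ a * K ^ b * D ^ (r / 2) := by
        rw [ENNReal.mul_rpow_of_nonneg _ _ ha0, ENNReal.mul_rpow_of_nonneg _ _ hb0,
          ← ENNReal.rpow_mul, mul_mul_mul_comm, ← ENNReal.rpow_add_of_nonneg _ _ ha0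
          (mul_nonneg (by linarith) hb0)]
        congr 2
        linarith

variable {d : ℕ}

/-- `∫ |∇(φ²)| ≤ 2 ‖φ‖ ‖∇φ‖`, by the Cauchy-Schwarz inequality. -/
theorem lintegral_fderiv_sq_le {φ : Eu d → ℝ} (hφ : ContDiff ℝ 1 φ) :
    ∫⁻ x, ‖fderiv ℝ (fun y => φ y ^ 2) x‖ₑ ≤ 2 * ((∫⁻ x, ‖φ x‖ₑ ^ (2 : ℝ)) ^ (1 / 2 : ℝ) *
      (∫⁻ x, ‖fderiv ℝ φ x‖ₑ ^ (2 : ℝ)) ^ (1 / 2 : ℝ)) := by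
  have hd : Differentiable ℝ φ := hφ.differentiable (by simp)
  have hc : Continuous (fderiv ℝ φ) := hφ.continuous_fderiv (by simp)
  have hc0 : Continuous φ := hφ.continuous
  have h1 : ∀ x, ‖fderiv ℝ (fun y => φ y ^ 2) x‖ₑ
      = 2 * (‖φ x‖ₑ * ‖fderiv ℝ φ x‖ₑ) := fun x => by
    rw [((hd x).hasFDerivAt.pow 2).fderiv]
    simp [enorm_smul, enorm_mul, mul_assoc, Real.enorm_eq_ofReal_abs]
  simp_rw [h1]
  rw [lintegral_const_mul _ (by fun_prop)]
  gcongr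
  exact ENNReal.lintegral_mul_le_Lp_mul_Lq volume Real.HolderConjugate.two_two
    (by fun_prop) (by fun_prop)

/-- The one-dimensional Sobolev inequality, from the fundamental theorem of calculus for `φ²`. -/
theorem enorm_sq_le_lintegral_of_dim_one {φ : Eu 1 → ℝ} (hφ : ContDiff ℝ 1 φ)
    (hc : HasCompactSupport φ) (x : Eu 1) :
    ‖φ x‖ₑ ^ (2 : ℝ) ≤ ∫⁻ x, ‖fderiv ℝ (fun y => φ y ^ 2) x‖ₑ := by
  let e : ℝ ≃ₗᵢ[ℝ] Eu 1 := (OrthonormalBasis.singleton (Fin 1) ℝ).repr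
  have hψ : ContDiff ℝ 1 (fun y => φ y ^ 2) := hφ.pow 2
  have h1 : HasCompactSupport (fun t : ℝ => φ (e t) ^ 2) := by
    have : HasCompactSupport (fun t : ℝ => φ (e t)) :=
      hc.comp_homeomorph e.toHomeomorph
    exact this.comp_left (g := fun s => s ^ 2) (by simp)
  have h2 : ContDiff ℝ 1 (fun t : ℝ => φ (e t) ^ 2) :=
    hψ.comp e.toContinuousLinearEquiv.contDiff
  have h3 := h1.enorm_le_lintegral_Ici_deriv h2 (e.symm x)
  have h4 : ∀ t, ‖deriv (fun t : ℝ => φ (e t) ^ 2) t‖ₑ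
      ≤ ‖fderiv ℝ (fun y => φ y ^ 2) (e t)‖ₑ := fun t => by
    have hd : HasDerivAt (fun t : ℝ => φ (e t) ^ 2)
        (fderiv ℝ (fun y => φ y ^ 2) (e t) (e 1)) t := by
      have := ((hψ.differentiable (by simp)) (e t)).hasFDerivAt.comp_hasDerivAt t
        (e.toContinuousLinearEquiv.toContinuousLinearMap.hasDerivAt (x := t))
      exact this
    rw [hd.deriv, enorm_le_iff_norm_le]
    refine (ContinuousLinearMap.le_opNorm _ _).trans ?_
    rw [e.norm_map]
    simp
  calc ‖φ x‖ₑ ^ (2 : ℝ) = ‖φ (e (e.symm x)) ^ 2‖ₑ := by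
        rw [e.apply_symm_apply, enorm_pow]
        norm_num
    _ ≤ ∫⁻ t in Set.Iic (e.symm x), ‖deriv (fun t : ℝ => φ (e t) ^ 2) t‖ₑ := h3
    _ ≤ ∫⁻ t, ‖deriv (fun t : ℝ => φ (e t) ^ 2) t‖ₑ := setLIntegral_le_lintegral _ _
    _ ≤ ∫⁻ t, ‖fderiv ℝ (fun y => φ y ^ 2) (e t)‖ₑ := lintegral_mono h4
    _ = ∫⁻ x, ‖fderiv ℝ (fun y => φ y ^ 2) x‖ₑ :=
        e.measurePreserving.lintegral_comp (f := fun x => ‖fderiv ℝ (fun y => φ y ^ 2) x‖ₑ)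
          (by have := hψ.continuous_fderiv (by simp); fun_prop)

/-- For some exponent `s`, the `L^s` norm of `C¹_c` functions is controlled by their gradient, as
soon as their `L²` norm is. Here `s = 4` for `d ≤ 2`, and `s = 2d/(d-2)` for `d ≥ 3`. -/
theorem exists_sobolev_const (hd : 1 ≤ d) (c : ENNReal) (hc : c ≠ ⊤) {s : ℝ}
    (hs2 : d ≤ 2 → s = 4) (hs3 : 3 ≤ d → s = 2 * d / (d - 2)) :
    ∃ K : ℝ≥0∞, K ≠ ⊤ ∧ ∀ φ : Eu d → ℝ, ContDiff ℝ 1 φ → HasCompactSupport φ →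
      ∫⁻ x, ‖φ x‖ₑ ^ (2 : ℝ) ≤ c * ∫⁻ x, ‖fderiv ℝ φ x‖ₑ ^ (2 : ℝ) →
      ∫⁻ x, ‖φ x‖ₑ ^ s ≤ K * (∫⁻ x, ‖fderiv ℝ φ x‖ₑ ^ (2 : ℝ)) ^ (s / 2) := by
  have hfour : ∀ t : ℝ≥0∞, t ^ (4 : ℝ) = (t ^ (2 : ℝ)) ^ (2 : ℝ) := fun t => by
    rw [← ENNReal.rpow_mul]; norm_num
  have hsq : ∀ t : ℝ≥0∞, (t ^ (1 / 2 : ℝ)) ^ (2 : ℝ) = t := fun t => by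
    rw [← ENNReal.rpow_mul]; norm_num
  have hms : ∀ a b : ℝ≥0∞, (a * b) ^ (2 : ℝ) = a ^ (2 : ℝ) * b ^ (2 : ℝ) := fun a b =>
    ENNReal.mul_rpow_of_nonneg _ _ (by norm_num)
  rcases Nat.lt_or_ge 2 d with h3 | h2
  · have hs := hs3 h3
    have hd3 : (3 : ℝ) ≤ d := by exact_mod_cast h3
    have hs0 : 0 < s := by rw [hs]; exact div_pos (by linarith) (by linarith)
    let C : ℝ≥0∞ := eLpNormLESNormFDerivOfEqInnerConst (volume : Measure (Eu d)) 2
    refine ⟨C ^ s, ENNReal.rpow_ne_top_of_nonneg hs0.le ENNReal.coe_ne_top, fun φ h1 hk _ => ?_⟩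
    have h := eLpNorm_le_eLpNorm_fderiv_of_eq_inner (volume : Measure (Eu d)) (u := φ) h1 hk
      (p := 2) (p' := s.toNNReal) (by norm_num) (by simp; lia) (by
        rw [Real.coe_toNNReal _ hs0.le, hs]
        simp
        field_simp)
    have hp' : s.toNNReal ≠ 0 := by simpa using hs0
    have e1 := eLpNorm_nnreal_pow_eq_lintegral (f := φ) (μ := volume) hp'
    have e2 := eLpNorm_nnreal_pow_eq_lintegral (f := fderiv ℝ φ) (μ := volume) (p := 2) (by norm_num)
    rw [Real.coe_toNNReal _ hs0.le] at e1
    rw [NNReal.coe_ofNat] at e2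
    rw [← e1, ← e2, ← ENNReal.rpow_mul]
    calc _ ≤ (C * eLpNorm (fderiv ℝ φ) 2 volume) ^ s := by
          gcongr
          exact h
      _ = _ := by
          rw [ENNReal.mul_rpow_of_nonneg _ _ hs0.le]
          congr 2
          ring
  · have hs := hs2 h2
    subst hs
    have e2 : (4 : ℝ) / 2 = 2 := by norm_num
    rw [e2]
    obtain rfl | rfl : d = 1 ∨ d = 2 := by lia
    · refine ⟨2 * c ^ (3 / 2 : ℝ), ENNReal.mul_ne_top (by norm_num)
        (ENNReal.rpow_ne_top_of_nonneg (by norm_num) hc), fun φ h1 hk hN => ?_⟩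
      set N := ∫⁻ x, ‖φ x‖ₑ ^ (2 : ℝ)
      set D := ∫⁻ x, ‖fderiv ℝ φ x‖ₑ ^ (2 : ℝ)
      have hS : ∀ x, ‖φ x‖ₑ ^ (2 : ℝ) ≤ 2 * (N ^ (1 / 2 : ℝ) * D ^ (1 / 2 : ℝ)) := fun x =>
        (enorm_sq_le_lintegral_of_dim_one h1 hk x).trans (lintegral_fderiv_sq_le h1)
      have hm : Measurable fun x => ‖φ x‖ₑ ^ (2 : ℝ) := by
        have := h1.continuous; fun_prop
      calc ∫⁻ x, ‖φ x‖ₑ ^ (4 : ℝ)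
          = ∫⁻ x, ‖φ x‖ₑ ^ (2 : ℝ) * ‖φ x‖ₑ ^ (2 : ℝ) := by
            refine lintegral_congr fun x => ?_
            rw [← ENNReal.rpow_add_of_nonneg _ _ (by norm_num) (by norm_num)]
            norm_num
        _ ≤ ∫⁻ x, 2 * (N ^ (1 / 2 : ℝ) * D ^ (1 / 2 : ℝ)) * ‖φ x‖ₑ ^ (2 : ℝ) := by
            refine lintegral_mono fun x => ?_
            gcongr
            exact hS x
        _ = 2 * (N ^ (1 / 2 : ℝ) * D ^ (1 / 2 : ℝ)) * N := lintegral_const_mul _ hm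
        _ ≤ 2 * ((c * D) ^ (1 / 2 : ℝ) * D ^ (1 / 2 : ℝ)) * (c * D) := by gcongr
        _ = 2 * c ^ (3 / 2 : ℝ) * D ^ (2 : ℝ) := by
            rw [ENNReal.mul_rpow_of_nonneg _ _ (by norm_num), mul_assoc (c ^ (1 / 2 : ℝ)),
              ← ENNReal.rpow_add_of_nonneg _ _ (by norm_num) (by norm_num)]
            have e3 : c ^ (3 / 2 : ℝ) = c ^ (1 / 2 : ℝ) * c := by
              conv_rhs => rw [← ENNReal.rpow_one c, ← ENNReal.rpow_mul]
              rw [← ENNReal.rpow_add_of_nonneg _ _ (by norm_num) (by norm_num)]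
              norm_num
            have e4 : D ^ (2 : ℝ) = D * D := by
              rw [ENNReal.rpow_ofNat, sq]
            rw [e3, e4]
            norm_num
            ring
    · let C : ℝ≥0∞ := lintegralPowLePowLIntegralFDerivConst (volume : Measure (Eu 2)) 2
      refine ⟨C * (2 ^ (2 : ℝ) * c), ENNReal.mul_ne_top ENNReal.coe_ne_top
        (ENNReal.mul_ne_top (by norm_num) hc), fun φ h1 hk hN => ?_⟩
      set N := ∫⁻ x, ‖φ x‖ₑ ^ (2 : ℝ)
      set D := ∫⁻ x, ‖fderiv ℝ φ x‖ₑ ^ (2 : ℝ)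
      have h := lintegral_pow_le_pow_lintegral_fderiv (volume : Measure (Eu 2))
        (u := fun y => φ y ^ 2) (p := 2) (h1.pow 2)
        (hk.comp_left (g := fun s => s ^ 2) (by simp))
        (by simpa using Real.HolderConjugate.two_two)
      calc ∫⁻ x, ‖φ x‖ₑ ^ (4 : ℝ) = ∫⁻ x, ‖φ x ^ 2‖ₑ ^ (2 : ℝ) := by
            refine lintegral_congr fun x => ?_
            rw [hfour, enorm_pow]
            simp only [ENNReal.rpow_ofNat]
        _ ≤ C * (∫⁻ x, ‖fderiv ℝ (fun y => φ y ^ 2) x‖ₑ) ^ (2 : ℝ) := h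
        _ ≤ C * (2 * (N ^ (1 / 2 : ℝ) * D ^ (1 / 2 : ℝ))) ^ (2 : ℝ) := by
            gcongr
            exact lintegral_fderiv_sq_le h1
        _ = C * (2 ^ (2 : ℝ) * (N * D)) := by rw [hms, hms, hsq, hsq]
        _ ≤ C * (2 ^ (2 : ℝ) * (c * D * D)) := by gcongr
        _ = C * (2 ^ (2 : ℝ) * c) * D ^ (2 : ℝ) := by
            rw [ENNReal.rpow_ofNat D]
            ring

variable {O : Set (Eu d)}

theorem IsTestFunction.lintegral_restrict {φ : Eu d → ℝ} (hφ : IsTestFunction O φ) {s : ℝ}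
    (hs : 0 < s) : ∫⁻ x in O, ‖φ x‖ₑ ^ s = ∫⁻ x, ‖φ x‖ₑ ^ s :=
  setLIntegral_eq_of_support_subset fun x hx => hφ.2.2 (subset_tsupport _ (by
    intro h; exact hx (by simp [h, hs])))

theorem IsTestFunction.lintegral_gradient_restrict {φ : Eu d → ℝ} (hφ : IsTestFunction O φ) {s : ℝ}
    (hs : 0 < s) : ∫⁻ x in O, ‖gradient φ x‖ₑ ^ s = ∫⁻ x, ‖fderiv ℝ φ x‖ₑ ^ s := by
  have h1 : ∀ x, ‖gradient φ x‖ₑ = ‖fderiv ℝ φ x‖ₑ := fun x =>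
    (InnerProductSpace.toDual ℝ (Eu d)).symm.enorm_map _
  simp_rw [h1]
  refine setLIntegral_eq_of_support_subset fun x hx => hφ.2.2 (support_fderiv_subset ℝ ?_)
  intro h
  have h0 : ‖fderiv ℝ φ x‖ₑ = 0 := by rw [enorm_eq_nnnorm, h, nnnorm_zero]; rfl
  exact hx (by simp only [h0]; exact ENNReal.zero_rpow_of_pos hs)

/-- The Sobolev inequality on `H¹₀(O)` in the presence of the Poincaré inequality. -/
theorem exists_sobolev_H10 (hd : 1 ≤ d) (hO : IsOpen O) {lam : ℝ} (hlam : 0 < lam)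
    (hP : PoincareInequality O lam) {r : ℝ} (hr : 2 ≤ r) (hr4 : d ≤ 4 → r ≤ 4)
    (hrd : 5 ≤ d → r ≤ 2 * d / (d - 2)) :
    ∃ K : ℝ, 0 ≤ K ∧ ∀ w : H10 O,
      eLpNorm (w : L2 O) (ENNReal.ofReal r) (volume.restrict O) ≤ ENNReal.ofReal (K * ‖gradH10 w‖) := by
  obtain ⟨s, hs2, hs3, hrs, hs⟩ : ∃ s : ℝ, (d ≤ 2 → s = 4) ∧ (3 ≤ d → s = 2 * d / (d - 2)) ∧
      r ≤ s ∧ 2 < s := by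
    rcases Nat.lt_or_ge 2 d with h3 | h2
    · have hd3 : (3 : ℝ) ≤ d := by exact_mod_cast h3
      refine ⟨2 * d / (d - 2), fun h => absurd h (by lia), fun _ => rfl, ?_, ?_⟩
      · rcases Nat.lt_or_ge 4 d with h5 | h4
        · exact hrd h5
        · refine (hr4 h4).trans ?_
          have hd4 : (d : ℝ) ≤ 4 := by exact_mod_cast h4
          rw [le_div_iff₀ (by linarith)]
          linarith
      · rw [lt_div_iff₀ (by linarith)]
        linarith
    · exact ⟨4, fun _ => rfl, fun h => absurd h (by lia), hr4 (by lia), by norm_num⟩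
  obtain ⟨K₁, hK₁, hS⟩ := exists_sobolev_const hd (ENNReal.ofReal lam⁻¹) ENNReal.ofReal_ne_top
    hs2 hs3
  set K₂ : ℝ≥0∞ := ENNReal.ofReal lam⁻¹ ^ ((s - r) / (s - 2)) * K₁ ^ ((r - 2) / (s - 2)) with hK₂
  have hs0 : 0 < s - 2 := by linarith
  have hr0 : 0 < r := by linarith
  have hK₂t : K₂ ≠ ⊤ := ENNReal.mul_ne_top
    (ENNReal.rpow_ne_top_of_nonneg (div_nonneg (by linarith) hs0.le) ENNReal.ofReal_ne_top)
    (ENNReal.rpow_ne_top_of_nonneg (div_nonneg (by linarith) hs0.le) hK₁)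
  have hKt : K₂ ^ (1 / r) ≠ ⊤ := ENNReal.rpow_ne_top_of_nonneg (by positivity) hK₂t
  have htwo : ∀ {E : Type} [NormedAddCommGroup E] (f : Eu d → E),
      eLpNorm f 2 (volume.restrict O) ^ (2 : ℝ) = ∫⁻ x in O, ‖f x‖ₑ ^ (2 : ℝ) := fun f => by
    simpa using eLpNorm_nnreal_pow_eq_lintegral (f := f) (μ := volume.restrict O) (p := 2)
      (by norm_num)
  -- The inequality for test functions, which then passes to the limit by Fatou's lemma.
  have htest : ∀ (φ : Eu d → ℝ), IsTestFunction O φ →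
      eLpNorm φ (ENNReal.ofReal r) (volume.restrict O)
        ≤ K₂ ^ (1 / r) * eLpNorm (gradient φ) 2 (volume.restrict O) := by
    intro φ hφ
    have hpo : eLpNorm φ 2 (volume.restrict O) ^ (2 : ℝ)
        ≤ ENNReal.ofReal lam⁻¹ * eLpNorm (gradient φ) 2 (volume.restrict O) ^ (2 : ℝ) := by
      have h := hP ⟨_, hφ.mem_H10.mem⟩
      rw [hφ.mem_H10.gradH10_eq hO] at h
      simp only [Lp.norm_toLp] at h
      rw [← ENNReal.ofReal_toReal hφ.memLp.eLpNorm_ne_top,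
        ← ENNReal.ofReal_toReal hφ.memLp_gradient.eLpNorm_ne_top, ENNReal.ofReal_rpow_of_nonneg
        ENNReal.toReal_nonneg (by norm_num), ENNReal.ofReal_rpow_of_nonneg
        ENNReal.toReal_nonneg (by norm_num), ← ENNReal.ofReal_mul (by positivity)]
      refine ENNReal.ofReal_le_ofReal ?_
      rw [Real.rpow_ofNat, Real.rpow_ofNat, inv_mul_eq_div, le_div_iff₀ hlam, mul_comm]
      exact h
    rw [htwo, htwo, hφ.lintegral_restrict (by norm_num),
      hφ.lintegral_gradient_restrict (by norm_num)] at hpo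
    have h1 : ContDiff ℝ 1 φ := hφ.1.of_le (by exact_mod_cast le_top)
    have h := lintegral_rpow_le_of_interpolation (μ := volume) (f := fun x => ‖φ x‖ₑ)
      (by have := hφ.1.continuous; fun_prop) hr hrs hs hpo (hS φ h1 hφ.2.1 hpo)
    rw [← hφ.lintegral_restrict (by positivity), ← hφ.lintegral_gradient_restrict (by norm_num),
      ← htwo] at h
    rw [eLpNorm_eq_lintegral_rpow_enorm_toReal (by simpa using hr0) ENNReal.ofReal_ne_top,
      ENNReal.toReal_ofReal hr0.le]
    calc _ ≤ (K₂ * (eLpNorm (gradient φ) 2 (volume.restrict O) ^ (2 : ℝ)) ^ (r / 2)) ^ (1 / r) := by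
          gcongr
      _ = _ := by
          rw [ENNReal.mul_rpow_of_nonneg _ _ (by positivity), ← ENNReal.rpow_mul,
            ← ENNReal.rpow_mul]
          have : 2 * (r / 2 * (1 / r)) = 1 := by field_simp
          rw [this, ENNReal.rpow_one]
  refine ⟨(K₂ ^ (1 / r)).toReal, ENNReal.toReal_nonneg, fun w => ?_⟩
  obtain ⟨φ, hφ, t1, t2⟩ := gradH10_spec w
  obtain ⟨ns, hns, hae⟩ := (tendstoInMeasure_of_tendsto_eLpNorm (g := fun x => (w : L2 O) x)
    (by norm_num) (fun n => (hφ n).memLp.1) (Lp.memLp _).1 t1).exists_seq_tendsto_ae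
  have h := Lp.eLpNorm_lim_le_liminf_eLpNorm (p := ENNReal.ofReal r) (f := fun n x => φ (ns n) x)
      (fun n => (hφ _).memLp.1) (w : L2 O) hae
  refine h.trans ?_
  rw [ENNReal.ofReal_mul ENNReal.toReal_nonneg, ENNReal.ofReal_toReal hKt, Lp.norm_def,
    ENNReal.ofReal_toReal (Lp.eLpNorm_ne_top _)]
  have hlim : Tendsto (fun n => K₂ ^ (1 / r) * (eLpNorm (fun x => gradient (φ (ns n)) x
      - gradH10 w x) 2 (volume.restrict O) + eLpNorm (gradH10 w) 2 (volume.restrict O))) atTop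
      (𝓝 (K₂ ^ (1 / r) * eLpNorm (gradH10 w) 2 (volume.restrict O))) := by
    have := ENNReal.Tendsto.const_mul (a := K₂ ^ (1 / r)) ((t2.comp hns.tendsto_atTop).add_const
      (eLpNorm (gradH10 w) 2 (volume.restrict O))) (Or.inr hKt)
    simpa using this
  rw [← hlim.liminf_eq]
  refine liminf_le_liminf (Eventually.of_forall fun n => (htest _ (hφ _)).trans ?_)
  gcongr
  have : gradient (φ (ns n)) = (fun x => gradient (φ (ns n)) x - gradH10 w x) + ⇑(gradH10 w) := by
    ext1 x; simp
  conv_lhs => rw [this]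
  exact eLpNorm_add_le ((hφ _).memLp_gradient.1.sub (Lp.memLp _).1) (Lp.memLp _).1 (by norm_num)

end Sobolev

/-! ### The power nonlinearity -/

section Power

theorem hasDerivAt_abs_rpow_mul {p : ℝ} (hp : 2 ≤ p) (s : ℝ) :
    HasDerivAt (fun s : ℝ => |s| ^ (p - 2) * s) ((p - 1) * |s| ^ (p - 2)) s := by
  have hpos : ∀ t : ℝ, 0 < t →
      HasDerivAt (fun s : ℝ => |s| ^ (p - 2) * s) ((p - 1) * |t| ^ (p - 2)) t := fun t ht => by
    have h := Real.hasDerivAt_rpow_const (x := t) (p := p - 1) (Or.inl ht.ne')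
    rw [abs_of_pos ht]
    have e : p - 1 - 1 = p - 2 := by ring
    rw [e] at h
    refine h.congr_of_eventuallyEq ?_
    filter_upwards [lt_mem_nhds ht] with x hx
    rw [abs_of_pos hx, ← Real.rpow_add_one hx.ne']
    congr 1
    ring
  rcases lt_trichotomy s 0 with h | h | h
  · have h1 := ((hpos (-s) (neg_pos.2 h)).comp s (hasDerivAt_neg s)).neg
    rw [abs_neg] at h1
    exact (h1.congr_deriv (by ring)).congr_of_eventuallyEq (Eventually.of_forall fun x => by simp)
  · subst h
    rw [hasDerivAt_iff_tendsto_slope]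
    have hc : Continuous fun t : ℝ => |t| ^ (p - 2) :=
      continuous_abs.rpow_const fun _ => Or.inr (by linarith)
    -- For `p = 2` the convention `0 ^ 0 = 1` gives the correct derivative `1` at the origin.
    have e : (p - 1) * |(0 : ℝ)| ^ (p - 2) = |(0 : ℝ)| ^ (p - 2) := by
      rcases hp.eq_or_lt with rfl | hp
      · norm_num
      · rw [abs_zero, Real.zero_rpow (by linarith)]; simp
    rw [e]
    refine ((hc.tendsto 0).mono_left nhdsWithin_le_nhds).congr' ?_
    filter_upwards [self_mem_nhdsWithin] with t ht
    rw [slope_def_field]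
    simp only [mul_zero, sub_zero]
    rw [mul_div_assoc, div_self ht, mul_one]
  · exact hpos s h

/-- The nonlinearity `|s|^{p-2} s`. -/
theorem isMonotoneC1_power {p : ℝ} (hp : 2 ≤ p) :
    IsMonotoneC1 (fun s : ℝ => |s| ^ (p - 2) * s) fun s => (p - 1) * |s| ^ (p - 2) where
  hasDerivAt := hasDerivAt_abs_rpow_mul hp
  continuous_deriv := continuous_const.mul
    (continuous_abs.rpow_const fun _ => Or.inr (by linarith))
  deriv_nonneg s := mul_nonneg (by linarith) (by positivity)
  map_zero := by simp

theorem abs_power {p : ℝ} (hp : 2 ≤ p) (s : ℝ) : |(|s| ^ (p - 2) * s)| = |s| ^ (p - 1) := by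
  rw [abs_mul, abs_of_nonneg (by positivity : 0 ≤ |s| ^ (p - 2))]
  rcases eq_or_ne s 0 with rfl | h
  · rw [abs_zero, mul_zero, Real.zero_rpow (by linarith)]
  · rw [← Real.rpow_add_one (abs_ne_zero.2 h)]
    congr 1
    ring

theorem power_mul_self {p : ℝ} (hp : 2 ≤ p) (s : ℝ) : |s| ^ (p - 2) * s * s = |s| ^ p := by
  rcases eq_or_ne s 0 with rfl | h
  · rw [abs_zero, mul_zero, Real.zero_rpow (by linarith)]
  · rw [mul_assoc, ← abs_mul_abs_self s, ← mul_assoc, ← Real.rpow_add_one (abs_ne_zero.2 h),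
      ← Real.rpow_add_one (abs_ne_zero.2 h)]
    congr 1
    ring

/-- A mean value bound for a function with `|F' s| ≤ C |s|^q`. -/
theorem abs_sub_le_of_abs_deriv_le {F F' : ℝ → ℝ} (hF : ∀ s, HasDerivAt F (F' s) s) {C q : ℝ}
    (hC : 0 ≤ C) (hq : 0 ≤ q) (h : ∀ s, |F' s| ≤ C * |s| ^ q) (a b : ℝ) :
    |F a - F b| ≤ C * (|a| ^ q + |b| ^ q) * |a - b| := by
  have := Convex.norm_image_sub_le_of_norm_hasDerivWithin_le (f := F) (f' := F')
    (s := Set.uIcc b a) (C := C * (|a| ^ q + |b| ^ q)) (fun x _ => (hF x).hasDerivWithinAt)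
    (fun x hx => by
      rw [Real.norm_eq_abs]
      refine (h x).trans ?_
      gcongr
      have h1 : |x| ≤ max |a| |b| := by
        rcases Set.mem_uIcc.1 hx with hx | hx
        · rw [max_comm]; exact abs_le_max_abs_abs hx.1 hx.2
        · exact abs_le_max_abs_abs hx.1 hx.2
      refine (Real.rpow_le_rpow (abs_nonneg _) h1 hq).trans ?_
      rcases max_cases |a| |b| with ⟨h2, _⟩ | ⟨h2, _⟩
      · rw [h2]; linarith [Real.rpow_nonneg (abs_nonneg b) q]
      · rw [h2]; linarith [Real.rpow_nonneg (abs_nonneg a) q])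
    (convex_uIcc b a) Set.left_mem_uIcc Set.right_mem_uIcc
  exact this

theorem abs_rpow_sub_two_le {p : ℝ} (hp : 2 ≤ p) (s : ℝ) : |s| ^ (p - 2) ≤ 1 + |s| ^ (p - 1) := by
  rcases le_total |s| 1 with h | h
  · exact (Real.rpow_le_one (abs_nonneg _) h (by linarith)).trans
      (le_add_of_nonneg_right (by positivity))
  · linarith [Real.rpow_le_rpow_of_exponent_le h (show p - 2 ≤ p - 1 by linarith)]

/-- The growth condition of `IsMonotoneC1.exists_solution` for `|s|^{p-2} s`. -/
theorem abs_power_sub_le {p : ℝ} (hp : 2 ≤ p) (a b : ℝ) :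
    |(|a| ^ (p - 2) * a - |b| ^ (p - 2) * b)| ≤
      2 * (p - 1) * (1 + |(|a| ^ (p - 2) * a)| + |(|b| ^ (p - 2) * b)|) * |a - b| := by
  have h := abs_sub_le_of_abs_deriv_le (hasDerivAt_abs_rpow_mul hp) (C := p - 1) (q := p - 2)
    (by linarith) (by linarith) (fun s => by
      rw [abs_of_nonneg (mul_nonneg (by linarith) (by positivity))]) a b
  rw [abs_power hp, abs_power hp]
  refine h.trans ?_
  have h1 := abs_rpow_sub_two_le hp a
  have h2 := abs_rpow_sub_two_le hp b
  have h3 : 0 ≤ |a| ^ (p - 1) := by positivity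
  have h4 : 0 ≤ |b| ^ (p - 1) := by positivity
  rw [mul_comm 2 (p - 1), mul_assoc (p - 1) 2]
  gcongr
  · linarith
  · linarith

/-- `||a|^p - |b|^p| ≤ p (|a|^{p-1} + |b|^{p-1}) |a - b|`. -/
theorem abs_rpow_abs_sub_le {p : ℝ} (hp : 2 ≤ p) (a b : ℝ) :
    |(|a| ^ p - |b| ^ p)| ≤ p * (|a| ^ (p - 1) + |b| ^ (p - 1)) * |a - b| := by
  refine abs_sub_le_of_abs_deriv_le (F := fun s => |s| ^ p) (F' := fun s => p * |s| ^ (p - 2) * s)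
    (fun s => hasDerivAt_abs_rpow s (by linarith)) (by linarith) (by linarith) (fun s => ?_) a b
  rw [mul_assoc, abs_mul, abs_power hp, abs_of_nonneg (by linarith : 0 ≤ p)]

/-- The strong monotonicity of `|s|^{p-2} s`. -/
theorem power_mul_sub_ge {p : ℝ} (hp : 2 ≤ p) (a b : ℝ) :
    (|a| ^ (p - 2) + |b| ^ (p - 2)) * (a - b) ^ 2 / 2 ≤
      (|a| ^ (p - 2) * a - |b| ^ (p - 2) * b) * (a - b) := by
  have h : 0 ≤ (|a| ^ (p - 2) - |b| ^ (p - 2)) * (a ^ 2 - b ^ 2) := by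
    rw [← sq_abs a, ← sq_abs b]
    rcases le_total |a| |b| with h | h
    · have h1 := Real.rpow_le_rpow (abs_nonneg _) h (by linarith : 0 ≤ p - 2)
      have h2 := pow_le_pow_left₀ (abs_nonneg _) h 2
      exact mul_nonneg_of_nonpos_of_nonpos (by linarith) (by linarith)
    · have h1 := Real.rpow_le_rpow (abs_nonneg _) h (by linarith : 0 ≤ p - 2)
      have h2 := pow_le_pow_left₀ (abs_nonneg _) h 2
      exact mul_nonneg (by linarith) (by linarith)
  nlinarith

end Power

/-! ### Integrability of elements of `D(A)` -/

section Regularity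

variable {d : ℕ} {O : Set (Eu d)}

theorem L2_norm_sq_eq {α : Type*} [MeasurableSpace α] {μ : Measure α} {E : Type*}
    [NormedAddCommGroup E] [InnerProductSpace ℝ E] (k : Lp E 2 μ) :
    ‖k‖ ^ 2 = ∫ x, ‖k x‖ ^ 2 ∂μ := by
  rw [← real_inner_self_eq_norm_sq, L2.inner_def]
  simp_rw [real_inner_self_eq_norm_sq]

theorem L2_integrable_norm_sq {α : Type*} [MeasurableSpace α] {μ : Measure α} {E : Type*}
    [NormedAddCommGroup E] (k : Lp E 2 μ) : Integrable (fun x => ‖k x‖ ^ 2) μ :=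
  (memLp_two_iff_integrable_sq_norm (Lp.memLp k).1).1 (Lp.memLp k)

/-- The energy estimate behind the integrability of `u ∈ D(A)`: with `t = (1 + ε β)⁻¹ u` and
`β(t) = |t|^{p-2} t`, the function `w = |t|^{p/2-1} t` satisfies `|∇w|² ≤ p²/(4(p-1)) ∇β(t)·∇u`. -/
theorem exists_half_power (hO : IsOpen O) {p : ℝ} (hp : 2 ≤ p) {u : H10 O} {f : L2 O}
    (h : IsNegLaplacian u f) {ε : ℝ} (hε : 0 < ε) :
    ∃ w : H10 O, (∀ᵐ x ∂volume.restrict O, |(w : L2 O) x|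
        = |scalarRes (fun s : ℝ => |s| ^ (p - 2) * s) ε ((u : L2 O) x)| ^ (p / 2)) ∧
      ‖gradH10 w‖ ^ 2 ≤ p ^ 2 / (4 * (p - 1)) *
        inner ℝ f ((isMonotoneC1_power hp).yosidaL2 hε (u : L2 O)) := by
  set β : ℝ → ℝ := fun s => |s| ^ (p - 2) * s with hβd
  set β' : ℝ → ℝ := fun s => (p - 1) * |s| ^ (p - 2) with hβ'd
  have hβ : IsMonotoneC1 β β' := isMonotoneC1_power hp
  set c : ℝ := p ^ 2 / (4 * (p - 1)) with hc
  have hp1 : 0 < p - 1 := by linarith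
  have hc0 : 0 ≤ c := by positivity
  have hq : 2 ≤ p / 2 + 1 := by linarith
  have hh := isMonotoneC1_power hq
  let W : ℝ → ℝ := fun s => |scalarRes β ε s| ^ (p / 2 + 1 - 2) * scalarRes β ε s
  let W' : ℝ → ℝ := fun s => (p / 2 + 1 - 1) * |scalarRes β ε s| ^ (p / 2 + 1 - 2) *
    (1 + ε * β' (scalarRes β ε s))⁻¹
  have hW : ∀ s, HasDerivAt W (W' s) s := fun s =>
    (hasDerivAt_abs_rpow_mul hq (scalarRes β ε s)).comp s (hβ.hasDerivAt_res hε s)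
  have hW'c : Continuous W' :=
    (hh.continuous_deriv.comp (hβ.lipschitzWith_res hε).continuous).mul
      (hβ.continuous_inv_one_add hε)
  have hW0 : W 0 = 0 := by simp [W, hβ.res_zero hε]
  -- `W'² = c β'(t) (1 + ε β'(t))⁻²`, while the Yosida approximation has derivative
  -- `β'(t) (1 + ε β'(t))⁻¹`.
  have hsq : ∀ s, W' s ^ 2 ≤ c * (β' (scalarRes β ε s) * (1 + ε * β' (scalarRes β ε s))⁻¹) := by
    intro s
    set t := scalarRes β ε s
    have hb := hβ.deriv_nonneg t
    have h1 : ((p / 2 + 1 - 1) * |t| ^ (p / 2 + 1 - 2)) ^ 2 = c * β' t := by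
      have : (|t| ^ (p / 2 + 1 - 2)) ^ 2 = |t| ^ (p - 2) := by
        rw [← Real.rpow_mul_natCast (abs_nonneg t)]
        congr 1
        push_cast
        ring
      rw [mul_pow, this, hc, hβ'd]
      field_simp
      ring
    have h2 : (1 + ε * β' t)⁻¹ ≤ 1 := inv_le_one_of_one_le₀ (by
      have := mul_nonneg hε.le hb
      linarith)
    have h3 : 0 ≤ (1 + ε * β' t)⁻¹ := by positivity
    have h4 : (1 + ε * β' t)⁻¹ ^ 2 ≤ (1 + ε * β' t)⁻¹ := by nlinarith
    simp only [W']
    rw [mul_pow, h1, mul_assoc]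
    gcongr
  have hWL : ∀ s, |W' s| ≤ Real.sqrt (c * ε⁻¹) := fun s => by
    refine Real.abs_le_sqrt ((hsq s).trans ?_)
    gcongr
    exact (le_abs_self _).trans (hβ.abs_yosida_deriv_le hε s)
  have hLip : LipschitzWith (Real.toNNReal (Real.sqrt (c * ε⁻¹))) W :=
    lipschitzWith_of_nnnorm_deriv_le (fun s => (hW s).differentiableAt) fun s => by
      rw [(hW s).deriv, ← NNReal.coe_le_coe, Real.coe_toNNReal _ (Real.sqrt_nonneg _)]
      exact hWL s
  have hm : MemLp (fun x => W' ((u : L2 O) x) • gradH10 u x) 2 (volume.restrict O) :=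
    (Lp.memLp (gradH10 u)).of_le_mul (c := Real.sqrt (c * ε⁻¹))
      ((hW'c.comp_aestronglyMeasurable (Lp.memLp _).1).smul (Lp.memLp _).1)
      (Eventually.of_forall fun x => by
        rw [norm_smul]; gcongr; exact hWL _)
  have hg := (gradH10_spec u).comp hW hW'c hW0 hWL (hLip.coeFn_compLp hW0 (u : L2 O)) hm.coeFn_toLp
  refine ⟨⟨_, hg.mem⟩, ?_, ?_⟩
  · filter_upwards [hLip.coeFn_compLp hW0 (u : L2 O)] with x hx
    rw [hx]
    simp only [Function.comp, W]
    rw [abs_power hq]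
    congr 1
    ring
  · rw [hg.gradH10_eq hO, h.inner_comp hO (hβ.hasDerivAt_yosida hε) (hβ.continuous_yosida_deriv hε)
      (hβ.yosida_zero hε) (hβ.abs_yosida_deriv_le hε) (hβ.coeFn_yosidaL2 hε _), L2_norm_sq_eq,
      ← integral_const_mul]
    refine integral_mono_ae (L2_integrable_norm_sq _) ?_ ?_
    · refine Integrable.const_mul ?_ _
      refine Integrable.bdd_mul (c := ε⁻¹) (L2_integrable_norm_sq (gradH10 u))
        ((hβ.continuous_yosida_deriv hε).comp_aestronglyMeasurable (Lp.memLp _).1)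
        (Eventually.of_forall fun x => hβ.abs_yosida_deriv_le hε _)
    · filter_upwards [hm.coeFn_toLp] with x hx
      rw [hx, norm_smul, mul_pow, Real.norm_eq_abs, sq_abs, ← mul_assoc]
      gcongr
      exact hsq _

/-- If `H¹₀(O)` embeds into `L^r(O)` with `r = 4(p-1)/p`, then `u ∈ D(A)` satisfies
`|u|^{p-2} u ∈ L²(O)`. For the Yosida approximations `y` of `|u|^{p-2} u`, the embedding applied to
`exists_half_power` gives `‖y‖² ≤ C (‖f‖ ‖y‖)^{r/2}` with `r / 2 < 2`, a bound uniform in `ε`. -/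
theorem memLp_power_of_isNegLaplacian (hO : IsOpen O) {p : ℝ} (hp : 2 ≤ p) {C : ℝ} (hC : 0 ≤ C)
    (hS : ∀ w : H10 O, eLpNorm (w : L2 O) (ENNReal.ofReal (4 * (p - 1) / p)) (volume.restrict O)
      ≤ ENNReal.ofReal (C * ‖gradH10 w‖)) {u : H10 O} {f : L2 O} (h : IsNegLaplacian u f) :
    MemLp (powerFun p (u : L2 O)) 2 (volume.restrict O) := by
  have hβ := isMonotoneC1_power hp
  set c : ℝ := p ^ 2 / (4 * (p - 1)) with hc
  set r : ℝ := 4 * (p - 1) / p with hr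
  have hp1 : 0 < p - 1 := by linarith
  have hp0 : 0 < p := by linarith
  have hr0 : 0 < r := by positivity
  have hc0 : 0 ≤ c := by positivity
  set M : ℝ := C ^ r * (c * ‖f‖) ^ (r / 2) with hM
  have hM0 : 0 ≤ M := by positivity
  have hbound : ∀ {ε : ℝ} (hε : 0 < ε), ‖hβ.yosidaL2 hε (u : L2 O)‖ ≤ M ^ (p / 2) := by
    intro ε hε
    obtain ⟨w, hw1, hw2⟩ := exists_half_power hO hp h hε
    set y := hβ.yosidaL2 hε (u : L2 O) with hy
    have e1 : eLpNorm (w : L2 O) (ENNReal.ofReal r) (volume.restrict O) ^ r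
        = eLpNorm y 2 (volume.restrict O) ^ (2 : ℝ) := by
      have a1 := eLpNorm_nnreal_pow_eq_lintegral (f := (w : L2 O)) (μ := volume.restrict O)
        (p := r.toNNReal) (by simpa using hr0)
      have a2 := eLpNorm_nnreal_pow_eq_lintegral (f := y) (μ := volume.restrict O)
        (p := 2) (by norm_num)
      rw [Real.coe_toNNReal _ hr0.le] at a1
      rw [NNReal.coe_ofNat] at a2
      refine a1.trans (Eq.trans ?_ a2.symm)
      refine lintegral_congr_ae ?_
      filter_upwards [hw1, hβ.coeFn_yosidaL2 hε (u : L2 O)] with x h1 h2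
      rw [hy, h2, Real.enorm_eq_ofReal_abs, Real.enorm_eq_ofReal_abs, h1, abs_power hp,
        ENNReal.ofReal_rpow_of_nonneg (by positivity) hr0.le,
        ENNReal.ofReal_rpow_of_nonneg (by positivity) (by norm_num), ← Real.rpow_mul (abs_nonneg _),
        ← Real.rpow_mul (abs_nonneg _)]
      congr 2
      rw [hr]
      field_simp
      ring
    have e2 : ‖y‖ ^ (2 : ℝ) ≤ (C * ‖gradH10 w‖) ^ r := by
      have := ENNReal.rpow_le_rpow (hS w) hr0.le
      rw [e1, ENNReal.ofReal_rpow_of_nonneg (by positivity) hr0.le,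
        ← ENNReal.ofReal_toReal (Lp.eLpNorm_ne_top y), ENNReal.ofReal_rpow_of_nonneg
        ENNReal.toReal_nonneg (by norm_num)] at this
      exact (ENNReal.ofReal_le_ofReal_iff (by positivity)).1 this
    have e3 : ‖gradH10 w‖ ^ 2 ≤ c * ‖f‖ * ‖y‖ := by
      refine hw2.trans ?_
      rw [mul_assoc]
      gcongr
      exact real_inner_le_norm _ _
    have e4 : ‖gradH10 w‖ ^ r ≤ (c * ‖f‖) ^ (r / 2) * ‖y‖ ^ (r / 2) := by
      rw [← Real.mul_rpow (by positivity) (by positivity)]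
      have : ‖gradH10 w‖ ^ r = (‖gradH10 w‖ ^ 2) ^ (r / 2) := by
        rw [← Real.rpow_natCast_mul (norm_nonneg _)]
        congr 1
        push_cast
        ring
      rw [this]
      gcongr
    have e5 : ‖y‖ ^ (2 : ℝ) ≤ M * ‖y‖ ^ (r / 2) := by
      refine e2.trans ?_
      rw [Real.mul_rpow hC (norm_nonneg _), hM, mul_assoc]
      gcongr
    rcases (norm_nonneg y).eq_or_lt with hy0 | hy0
    · rw [← hy0]; positivity
    -- `2 - r / 2 = 2 / p`
    · have e6 : ‖y‖ ^ (2 / p) ≤ M := by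
        refine le_of_mul_le_mul_right ?_ (Real.rpow_pos_of_pos hy0 (r / 2))
        rw [← Real.rpow_add hy0]
        have e7 : 2 / p + r / 2 = 2 := by
          rw [hr]
          field_simp
          ring
        rw [e7]
        exact e5
      calc ‖y‖ = (‖y‖ ^ (2 / p)) ^ (p / 2) := by
            rw [← Real.rpow_mul hy0.le]
            have : 2 / p * (p / 2) = 1 := by field_simp
            rw [this, Real.rpow_one]
        _ ≤ M ^ (p / 2) := by gcongr
  have hε : ∀ n : ℕ, 0 < 1 / ((n : ℝ) + 1) := fun n => by positivity
  refine ⟨hβ.continuous.comp_aestronglyMeasurable (Lp.memLp (u : L2 O)).1, ?_⟩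
  refine lt_of_le_of_lt (eLpNorm_le_of_ae_tendsto
    (f := fun n x => hβ.yosidaL2 (hε n) (u : L2 O) x)
    (fun n => (Lp.memLp _).1) ?_ fun n => ?_) (ENNReal.ofReal_lt_top (r := M ^ (p / 2)))
  · filter_upwards [ae_all_iff.2 fun n => hβ.coeFn_yosidaL2 (hε n) (u : L2 O)] with x hx
    simp only [hx]
    exact (hβ.continuous.tendsto _).comp
      (hβ.tendsto_res hε tendsto_one_div_add_atTop_nhds_zero_nat _)
  · rw [← ENNReal.ofReal_toReal (Lp.eLpNorm_ne_top (hβ.yosidaL2 (hε n) (u : L2 O)))]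
    exact ENNReal.ofReal_le_ofReal (hbound (hε n))

end Regularity

/-! ### The cut-off and accretivity -/

section Accretive

/-- The scalar cut-off: `g^K(u) = cutCoeff K (E(u)) u`. -/
noncomputable def cutCoeff (K s : ℝ) : ℝ := if s ≤ K then s else K ^ 2 / s

theorem cutCoeff_le {K : ℝ} (hK : 0 ≤ K) (s : ℝ) : cutCoeff K s ≤ K := by
  unfold cutCoeff
  split_ifs with h
  · exact h
  · push Not at h
    rw [div_le_iff₀ (hK.trans_lt h), sq]
    gcongr

/-- Continuity holds for `K = 0` too, where the coefficient vanishes for `s ≥ 0`. -/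
theorem continuous_cutCoeff {K : ℝ} (hK : 0 ≤ K) : Continuous (cutCoeff K) := by
  have h1 : cutCoeff K = fun s => if s ≤ K then s else K ^ 2 / max s K := by
    funext s
    unfold cutCoeff
    split_ifs with h
    · rfl
    · rw [max_eq_left (not_le.1 h).le]
  rw [h1]
  rcases hK.eq_or_lt with rfl | hK
  · simp only [ne_eq, OfNat.ofNat_ne_zero, not_false_eq_true, zero_pow, zero_div]
    exact continuous_id.if_le continuous_const continuous_id continuous_const fun x hx => hx
  · refine continuous_id.if_le ?_ continuous_id continuous_const fun x hx => ?_
    · exact continuous_const.div (continuous_id.max continuous_const) fun x =>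
        (hK.trans_le (le_max_right _ _)).ne'
    · have hx : x = K := hx
      rw [hx, max_self]
      change K = K ^ 2 / K
      field_simp

/-- The scalar inequality on the cut-off that makes its constant independent of the energies. -/
theorem abs_cutCoeff_sub_mul_le {K a b : ℝ} (hK : 0 ≤ K) (hb : 0 ≤ b) (hab : b ≤ a) :
    |cutCoeff K a - cutCoeff K b| * (√a * √b) ≤ K * (a - b) := by
  have ha : 0 ≤ a := hb.trans hab
  have hsa := Real.mul_self_sqrt ha
  have hsb := Real.mul_self_sqrt hb
  have hs := Real.sqrt_le_sqrt hab
  have hb0 := Real.sqrt_nonneg b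
  have ha0 := Real.sqrt_nonneg a
  have hm : √a * √b ≤ a := by nlinarith
  unfold cutCoeff
  split_ifs with h1 h2 h2
  · rw [abs_of_nonneg (by linarith), mul_comm]
    gcongr
    linarith
  · linarith
  · push Not at h1
    have ha' : 0 < a := hK.trans_lt h1
    have e : K ^ 2 / a - b = (K ^ 2 - a * b) / a := by field_simp
    have h3 : |K ^ 2 - a * b| ≤ K * (a - b) := by
      rw [abs_le]
      constructor <;> nlinarith
    rw [e, abs_div, abs_of_pos ha', div_mul_eq_mul_div, div_le_iff₀ ha']
    gcongr
  · push Not at h1 h2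
    have ha' : 0 < a := hK.trans_lt h1
    have hb' : 0 < b := hK.trans_lt h2
    have e : K ^ 2 / a - K ^ 2 / b = -(K ^ 2 * (a - b) / (a * b)) := by field_simp; ring
    have h3 : K ≤ √a * √b := by nlinarith
    rw [e, abs_neg, abs_of_nonneg (div_nonneg (mul_nonneg (sq_nonneg _) (by linarith))
      (by positivity)), div_mul_eq_mul_div, div_le_iff₀ (by positivity)]
    have h4 : a * b = (√a * √b) * (√a * √b) := by
      rw [mul_mul_mul_comm, hsa, hsb]
    rw [h4]
    have h5 : 0 ≤ K * (a - b) * (√a * √b) :=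
      mul_nonneg (mul_nonneg hK (by linarith)) (by positivity)
    nlinarith

/-- Optimization over `τ` in Young's inequality. -/
theorem sq_le_of_forall_young {X A B : ℝ} (hX : 0 ≤ X) (hA : 0 ≤ A)
    (h : ∀ τ : ℝ, 0 < τ → τ * X ≤ τ ^ 2 * A + B) : X ^ 2 ≤ 4 * A * B := by
  have hB : 0 ≤ B := by
    have hc : Continuous fun τ : ℝ => τ ^ 2 * A + B - τ * X := by fun_prop
    have := ge_of_tendsto (b := (0 : ℝ)) ((hc.tendsto 0).mono_left nhdsWithin_le_nhds)
      (by filter_upwards [self_mem_nhdsWithin (s := Set.Ioi (0 : ℝ))] with τ hτ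
          linarith [h τ hτ])
    simpa using this
  rcases hX.eq_or_lt with rfl | hX
  · simp only [ne_eq, OfNat.ofNat_ne_zero, not_false_eq_true, zero_pow]
    positivity
  rcases hA.eq_or_lt with rfl | hA
  · have := h ((B + 1) / X) (by positivity)
    rw [div_mul_cancel₀ _ hX.ne'] at this
    linarith
  · have := h (X / (2 * A)) (by positivity)
    field_simp at this
    nlinarith

variable {d : ℕ} {O : Set (Eu d)} {p : ℝ}

theorem energy_nonneg (u : H10 O) : 0 ≤ energy p u :=
  add_nonneg (sq_nonneg _) (integral_nonneg fun _ => by positivity)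

theorem cutg_eq (K : ℕ) (u : H10 O) : cutg p K u = cutCoeff K (energy p u) • (u : L2 O) := by
  unfold cutg cutCoeff opg
  split_ifs with h
  · rfl
  · have h0 : energy p u ≠ 0 := ((Nat.cast_nonneg K).trans_lt (not_le.1 h)).ne'
    rw [smul_smul]
    congr 1
    field_simp

theorem coeFn_powerL2 {u : L2 O} (h : MemLp (powerFun p u) 2 (volume.restrict O)) :
    ∀ᵐ x ∂volume.restrict O, powerL2 p u x = |u x| ^ (p - 2) * u x := by
  unfold powerL2
  rw [dif_pos h]
  exact h.coeFn_toLp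

theorem integrable_abs_rpow (hp : 2 ≤ p) {u : L2 O}
    (h : MemLp (powerFun p u) 2 (volume.restrict O)) :
    Integrable (fun x => |u x| ^ p) (volume.restrict O) := by
  refine (h.integrable_mul (Lp.memLp u)).congr (Eventually.of_forall fun x => ?_)
  exact power_mul_self hp (u x)

theorem inner_powerL2 (hp : 2 ≤ p) {u : L2 O} (h : MemLp (powerFun p u) 2 (volume.restrict O)) :
    inner ℝ (powerL2 p u) u = ∫ x in O, |u x| ^ p := by
  rw [L2_inner_eq]
  refine integral_congr_ae ?_
  filter_upwards [coeFn_powerL2 h] with x hx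
  rw [hx, power_mul_self hp]

theorem inner_powerL2_sub_nonneg (hp : 2 ≤ p) {u v : L2 O}
    (hu : MemLp (powerFun p u) 2 (volume.restrict O))
    (hv : MemLp (powerFun p v) 2 (volume.restrict O)) :
    0 ≤ (inner ℝ (powerL2 p u - powerL2 p v) (u - v) : ℝ) := by
  refine L2_inner_nonneg ?_
  filter_upwards [coeFn_powerL2 hu, coeFn_powerL2 hv, Lp.coeFn_sub u v,
    Lp.coeFn_sub (powerL2 p u) (powerL2 p v)] with x h1 h2 h3 h4
  rw [h4, h3, Pi.sub_apply, Pi.sub_apply, h1, h2]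
  exact (isMonotoneC1_power hp).mul_nonneg _ _

/-- The strong monotonicity of `|u|^{p-2} u` controls the differences of `∫ |u|^p`. -/
theorem sq_integral_rpow_sub_le (hp : 2 ≤ p) {u v : L2 O}
    (hu : MemLp (powerFun p u) 2 (volume.restrict O))
    (hv : MemLp (powerFun p v) 2 (volume.restrict O)) :
    ((∫ x in O, |u x| ^ p) - ∫ x in O, |v x| ^ p) ^ 2 ≤
      2 * p ^ 2 * ((∫ x in O, |u x| ^ p) + ∫ x in O, |v x| ^ p) *
        inner ℝ (powerL2 p u - powerL2 p v) (u - v) := by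
  have hiu := integrable_abs_rpow hp hu
  have hiv := integrable_abs_rpow hp hv
  have hi : Integrable (fun x => |u x| ^ p + |v x| ^ p) (volume.restrict O) := hiu.add hiv
  have hp0 : 0 ≤ p := by linarith
  set D : ℝ := inner ℝ (powerL2 p u - powerL2 p v) (u - v) with hD
  set A : ℝ := (∫ x in O, |u x| ^ p) + ∫ x in O, |v x| ^ p with hA
  have hA0 : 0 ≤ A := add_nonneg (integral_nonneg fun _ => by positivity)
    (integral_nonneg fun _ => by positivity)
  have key : ∀ τ : ℝ, 0 < τ → τ * |(∫ x in O, |u x| ^ p) - ∫ x in O, |v x| ^ p|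
      ≤ τ ^ 2 * (p / 2 * A) + p * D := by
    intro τ hτ
    rw [← integral_sub hiu hiv]
    refine (mul_le_mul_of_nonneg_left abs_integral_le_integral_abs hτ.le).trans ?_
    have hR : τ ^ 2 * (p / 2 * A) + p * D = ∫ x in O, (τ ^ 2 * (p / 2)) * (|u x| ^ p + |v x| ^ p)
        + p * ((powerL2 p u - powerL2 p v : L2 O) x * (u - v : L2 O) x) := by
      rw [integral_add (hi.const_mul _) ((L2_integrable_mul _ _).const_mul _),
        integral_const_mul, integral_const_mul, integral_add hiu hiv, ← L2_inner_eq]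
      ring
    rw [hR, ← integral_const_mul]
    refine integral_mono_ae ((hiu.sub hiv).abs.const_mul _)
      ((hi.const_mul _).add ((L2_integrable_mul _ _).const_mul _)) ?_
    filter_upwards [coeFn_powerL2 hu, coeFn_powerL2 hv, Lp.coeFn_sub u v,
      Lp.coeFn_sub (powerL2 p u) (powerL2 p v)] with x h1 h2 h3 h4
    rw [h4, h3, Pi.sub_apply, Pi.sub_apply, h1, h2]
    set a := u x
    set b := v x
    have i1 := abs_rpow_abs_sub_le hp a b
    have i2 := power_mul_sub_ge hp a b
    have young : ∀ s : ℝ, τ * (|s| ^ (p - 1) * |a - b|)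
        ≤ (τ ^ 2 * |s| ^ p + |s| ^ (p - 2) * (a - b) ^ 2) / 2 := fun s => by
      have e1 : |s| ^ (p - 1) = |s| ^ (p - 2) * |s| := by
        rw [← abs_power hp, abs_mul, abs_of_nonneg (by positivity : 0 ≤ |s| ^ (p - 2))]
      have e2 : |s| ^ p = |s| ^ (p - 2) * |s| ^ 2 := by
        rw [← power_mul_self hp, mul_assoc, sq_abs, sq]
      rw [e1, e2, ← sq_abs (a - b)]
      have := mul_nonneg (by positivity : 0 ≤ |s| ^ (p - 2)) (sq_nonneg (τ * |s| - |a - b|))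
      nlinarith
    have y1 := young a
    have y2 := young b
    calc τ * |(|a| ^ p - |b| ^ p)| ≤ τ * (p * (|a| ^ (p - 1) + |b| ^ (p - 1)) * |a - b|) := by gcongr
      _ = p * (τ * (|a| ^ (p - 1) * |a - b|) + τ * (|b| ^ (p - 1) * |a - b|)) := by ring
      _ ≤ p * ((τ ^ 2 * |a| ^ p + |a| ^ (p - 2) * (a - b) ^ 2) / 2
          + (τ ^ 2 * |b| ^ p + |b| ^ (p - 2) * (a - b) ^ 2) / 2) := by gcongr
      _ = τ ^ 2 * (p / 2) * (|a| ^ p + |b| ^ p)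
          + p * ((|a| ^ (p - 2) + |b| ^ (p - 2)) * (a - b) ^ 2 / 2) := by ring
      _ ≤ _ := by gcongr
  have h := sq_le_of_forall_young (abs_nonneg _) (by positivity) key
  rw [sq_abs] at h
  refine h.trans (le_of_eq ?_)
  ring

/-- Differences of energies are controlled by the square root of the monotone terms. -/
theorem energy_sub_le (hp : 2 ≤ p) {u v : H10 O}
    (hu : MemLp (powerFun p (u : L2 O)) 2 (volume.restrict O))
    (hv : MemLp (powerFun p (v : L2 O)) 2 (volume.restrict O)) (huv : energy p v ≤ energy p u) :
    energy p u - energy p v ≤ √(energy p u) * (2 * (‖gradH10 u - gradH10 v‖ + p *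
      √(inner ℝ (powerL2 p (u : L2 O) - powerL2 p (v : L2 O)) ((u : L2 O) - (v : L2 O))))) := by
  have hD0 := inner_powerL2_sub_nonneg hp hu hv
  have hI := sq_integral_rpow_sub_le hp hu hv
  have ha0 : 0 ≤ energy p u := energy_nonneg u
  have hb0 : 0 ≤ energy p v := energy_nonneg v
  have hPu0 : 0 ≤ ∫ x in O, |(u : L2 O) x| ^ p := integral_nonneg fun _ => by positivity
  have hPv0 : 0 ≤ ∫ x in O, |(v : L2 O) x| ^ p := integral_nonneg fun _ => by positivity
  have eu : energy p u = ‖gradH10 u‖ ^ 2 + ∫ x in O, |(u : L2 O) x| ^ p := rfl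
  have ev : energy p v = ‖gradH10 v‖ ^ 2 + ∫ x in O, |(v : L2 O) x| ^ p := rfl
  have i3 : ‖gradH10 u‖ - ‖gradH10 v‖ ≤ ‖gradH10 u - gradH10 v‖ := norm_sub_norm_le _ _
  have hG0 := norm_nonneg (gradH10 u - gradH10 v)
  have hu0 := norm_nonneg (gradH10 u)
  have hv0 := norm_nonneg (gradH10 v)
  generalize ‖gradH10 u - gradH10 v‖ = G at *
  generalize (inner ℝ (powerL2 p (u : L2 O) - powerL2 p (v : L2 O))
    ((u : L2 O) - (v : L2 O)) : ℝ) = D at *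
  generalize (∫ x in O, |(u : L2 O) x| ^ p) = Pu at *
  generalize (∫ x in O, |(v : L2 O) x| ^ p) = Pv at *
  generalize ‖gradH10 u‖ = gu at *
  generalize ‖gradH10 v‖ = gv at *
  generalize energy p u = a at *
  generalize energy p v = b at *
  have hgu : gu ≤ √a := Real.le_sqrt_of_sq_le (by linarith)
  have hgv : gv ≤ √a := Real.le_sqrt_of_sq_le (by linarith)
  have i1 : Pu - Pv ≤ 2 * p * √a * √D := by
    refine (le_abs_self _).trans (abs_le_of_sq_le_sq (hI.trans ?_) (by positivity))
    have : (2 * p * √a * √D) ^ 2 = 2 * p ^ 2 * (2 * a) * D := by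
      rw [mul_pow, mul_pow, Real.sq_sqrt ha0, Real.sq_sqrt hD0]; ring
    rw [this]
    gcongr
    linarith [sq_nonneg gu, sq_nonneg gv]
  have i2 : gu ^ 2 - gv ^ 2 ≤ 2 * √a * G := by
    have i5 : gu ^ 2 - gv ^ 2 = (gu + gv) * (gu - gv) := by ring
    rw [i5]
    refine (mul_le_mul_of_nonneg_left i3 (by positivity)).trans ?_
    gcongr
    linarith
  linarith

/-- The accretivity estimate, with the two functions ordered by their energies. The constant `1 + p²` is
smaller than the `2 + p² 2^{2p-3}` of the main statement. -/
theorem inner_cutg_sub_le {lam : ℝ} (hlam : 0 < lam)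
    (hP : PoincareInequality O lam) (hp : 2 ≤ p) (K : ℕ) {u v : H10 O}
    (hu : MemLp (powerFun p (u : L2 O)) 2 (volume.restrict O))
    (hv : MemLp (powerFun p (v : L2 O)) 2 (volume.restrict O)) (huv : energy p v ≤ energy p u) :
    inner ℝ (cutg p K u - cutg p K v) ((u : L2 O) - (v : L2 O)) ≤
      ‖gradH10 u - gradH10 v‖ ^ 2 +
      inner ℝ (powerL2 p (u : L2 O) - powerL2 p (v : L2 O)) ((u : L2 O) - (v : L2 O)) +
      (1 + (1 + p ^ 2) * (K : ℝ) * lam⁻¹) * (K : ℝ) * ‖(u : L2 O) - (v : L2 O)‖ ^ 2 := by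
  have hK : (0 : ℝ) ≤ K := Nat.cast_nonneg K
  have hb0 : 0 ≤ energy p v := energy_nonneg v
  have hD0 := inner_powerL2_sub_nonneg hp hu hv
  have hG0 := norm_nonneg (gradH10 u - gradH10 v)
  have hW0 := norm_nonneg ((u : L2 O) - (v : L2 O))
  have hPv0 : 0 ≤ ∫ x in O, |(v : L2 O) x| ^ p := integral_nonneg fun _ => by positivity
  have ev : energy p v = ‖gradH10 v‖ ^ 2 + ∫ x in O, |(v : L2 O) x| ^ p := rfl
  have hgv : ‖gradH10 v‖ ≤ √(energy p v) := Real.le_sqrt_of_sq_le (by linarith)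
  have hsab : √(energy p v) ≤ √(energy p u) := Real.sqrt_le_sqrt huv
  have hsl : 0 < √lam := Real.sqrt_pos.2 hlam
  have h1 := energy_sub_le hp hu hv huv
  have h2 := abs_cutCoeff_sub_mul_le hK hb0 huv
  have h4 : √lam * ‖(v : L2 O)‖ ≤ √(energy p v) := by
    refine (pow_le_pow_iff_left₀ (by positivity) (norm_nonneg _) two_ne_zero).1 ?_ |>.trans hgv
    rw [mul_pow, Real.sq_sqrt hlam.le]
    exact hP v
  have h6 : cutg p K u - cutg p K v = cutCoeff K (energy p u) • ((u : L2 O) - (v : L2 O))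
      + (cutCoeff K (energy p u) - cutCoeff K (energy p v)) • (v : L2 O) := by
    rw [cutg_eq, cutg_eq, smul_sub, sub_smul]
    abel
  have h7 : (cutCoeff K (energy p u) - cutCoeff K (energy p v))
        * inner ℝ (v : L2 O) ((u : L2 O) - (v : L2 O))
      ≤ |cutCoeff K (energy p u) - cutCoeff K (energy p v)| *
        (‖(v : L2 O)‖ * ‖(u : L2 O) - (v : L2 O)‖) := by
    refine (le_abs_self _).trans ?_
    rw [abs_mul]
    gcongr
    exact abs_real_inner_le_norm _ _
  rw [h6, inner_add_left, inner_smul_left, inner_smul_left, real_inner_self_eq_norm_sq,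
    RCLike.conj_to_real, RCLike.conj_to_real]
  have h8 := mul_le_mul_of_nonneg_right (cutCoeff_le hK (energy p u))
    (sq_nonneg ‖(u : L2 O) - (v : L2 O)‖)
  have hn0 := norm_nonneg (v : L2 O)
  generalize ‖gradH10 u - gradH10 v‖ = G at *
  generalize (inner ℝ (powerL2 p (u : L2 O) - powerL2 p (v : L2 O))
    ((u : L2 O) - (v : L2 O)) : ℝ) = D at *
  generalize ‖(u : L2 O) - (v : L2 O)‖ = W at *
  generalize ‖(v : L2 O)‖ = nv at *
  have hθ := abs_nonneg (cutCoeff K (energy p u) - cutCoeff K (energy p v))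
  generalize |cutCoeff K (energy p u) - cutCoeff K (energy p v)| = θ at *
  have h3 : θ * √(energy p v) ≤ K * (2 * (G + p * √D)) := by
    rcases (Real.sqrt_nonneg (energy p u)).eq_or_lt with h | h
    · have : √(energy p v) = 0 := le_antisymm (hsab.trans h.ge) (Real.sqrt_nonneg _)
      rw [this, mul_zero]
      positivity
    · refine le_of_mul_le_mul_right ?_ h
      calc θ * √(energy p v) * √(energy p u)
          = θ * (√(energy p u) * √(energy p v)) := by ring
        _ ≤ K * (energy p u - energy p v) := h2
        _ ≤ K * (√(energy p u) * (2 * (G + p * √D))) := by gcongr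
        _ = _ := by ring
  have h5 : θ * (nv * W) ≤ G ^ 2 + D + (1 + p ^ 2) * K ^ 2 * lam⁻¹ * W ^ 2 := by
    set Z := W / √lam with hZ
    have hZ0 : 0 ≤ Z := by positivity
    have e1 : lam⁻¹ * W ^ 2 = Z ^ 2 := by
      rw [hZ, div_pow, Real.sq_sqrt hlam.le]
      field_simp
    have e2 : √D ^ 2 = D := Real.sq_sqrt hD0
    calc θ * (nv * W) = θ * (√lam * nv) * Z := by
          rw [hZ]; field_simp
      _ ≤ θ * √(energy p v) * Z := by gcongr
      _ ≤ K * (2 * (G + p * √D)) * Z := by gcongr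
      _ = G ^ 2 + √D ^ 2 + (1 + p ^ 2) * K ^ 2 * Z ^ 2
          - ((G - K * Z) ^ 2 + (√D - p * K * Z) ^ 2) := by ring
      _ ≤ G ^ 2 + √D ^ 2 + (1 + p ^ 2) * K ^ 2 * Z ^ 2 := sub_le_self _ (by positivity)
      _ = _ := by rw [← e1, e2]; ring
  have h9 : (1 + (1 + p ^ 2) * (K : ℝ) * lam⁻¹) * (K : ℝ) * W ^ 2
      = K * W ^ 2 + (1 + p ^ 2) * K ^ 2 * lam⁻¹ * W ^ 2 := by ring
  rw [h9]
  linarith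

end Accretive

/-! ### The range of the cut-off operator -/

section Range

variable {d : ℕ} {O : Set (Eu d)} {p : ℝ}

theorem domA.coe_toH10 (u : domA O) : (domA.toH10 u : L2 O) = u := rfl

theorem opA_spec (u : domA O) : IsNegLaplacian (domA.toH10 u) (opA u) :=
  Classical.choose_spec (Exists.elim u.2 fun _ h => h :
    ∃ f : L2 O, IsNegLaplacian (domA.toH10 u) f)

/-- The equation `-Δu + |u|^{p-2} u + μ u = f`, together with the formula for the energy that follows
from testing with `u`. -/
theorem exists_power_solution (hO : IsOpen O) (hp : 2 ≤ p) {μ : ℝ} (hμ : 0 < μ) (f : L2 O) :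
    ∃ u : H10 O, MemLp (powerFun p (u : L2 O)) 2 (volume.restrict O) ∧
      IsNegLaplacian u (f - powerL2 p (u : L2 O) - μ • (u : L2 O)) ∧
      energy p u = inner ℝ f (u : L2 O) - μ * ‖(u : L2 O)‖ ^ 2 := by
  obtain ⟨u, b, hb, hu⟩ := (isMonotoneC1_power hp).exists_solution hO
    (C := 2 * (p - 1)) (by linarith) (abs_power_sub_le hp) hμ f
  have hm : MemLp (powerFun p (u : L2 O)) 2 (volume.restrict O) := (Lp.memLp b).ae_eq hb
  have hbe : b = powerL2 p (u : L2 O) := by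
    refine Lp.ext ?_
    filter_upwards [hb, coeFn_powerL2 hm] with x h1 h2
    rw [h1, h2]
  rw [hbe] at hu
  refine ⟨u, hm, hu, ?_⟩
  have h := hu u
  rw [real_inner_self_eq_norm_sq, inner_sub_left, inner_sub_left, inner_smul_left,
    real_inner_self_eq_norm_sq, RCLike.conj_to_real, inner_powerL2 hp hm] at h
  unfold energy
  rw [h]
  ring

/-- The equation `-Δu + |u|^{p-2} u - g^K(u) + γ u = f` for `γ > K`. Since `g^K(u) = θ(E(u)) u`, one
solves it with `θ(E(u))` frozen to `θ(s)` and then finds `s` with `E(u_s) = s` by the intermediate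
value theorem. -/
theorem exists_cut_solution (hO : IsOpen O) (hp : 2 ≤ p) (K : ℕ) {γ : ℝ} (hγ : K + 1 ≤ γ)
    (f : L2 O) :
    ∃ u : H10 O, MemLp (powerFun p (u : L2 O)) 2 (volume.restrict O) ∧
      IsNegLaplacian u (f - powerL2 p (u : L2 O) + cutg p K u - γ • (u : L2 O)) := by
  have hK : (0 : ℝ) ≤ K := Nat.cast_nonneg K
  have hμ1 : ∀ s, 1 ≤ γ - cutCoeff K s := fun s => by linarith [cutCoeff_le hK s]
  choose u hm hu hE using fun s : ℝ =>
    exists_power_solution hO hp (zero_lt_one.trans_le (hμ1 s)) f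
  have hn : ∀ s, ‖(u s : L2 O)‖ ≤ ‖f‖ := by
    intro s
    have h1 : 0 ≤ energy p (u s) := energy_nonneg _
    rw [hE] at h1
    have h2 := real_inner_le_norm f (u s : L2 O)
    have h3 := mul_le_mul_of_nonneg_right (hμ1 s) (sq_nonneg ‖(u s : L2 O)‖)
    rcases (norm_nonneg (u s : L2 O)).eq_or_lt with h | h
    · rw [← h]; positivity
    · refine le_of_mul_le_mul_right ?_ h
      nlinarith
  -- Subtracting the equations for `s` and `t` and testing with `u s - u t`.
  have hd : ∀ s t, ‖(u s : L2 O) - u t‖ ≤ |cutCoeff K s - cutCoeff K t| * ‖f‖ := by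
    intro s t
    have h1 := (hu s).inner_sub_nonneg hO (hu t)
    have h2 := inner_powerL2_sub_nonneg hp (hm s) (hm t)
    have h3 : f - powerL2 p (u s : L2 O) - (γ - cutCoeff K s) • (u s : L2 O)
        - (f - powerL2 p (u t : L2 O) - (γ - cutCoeff K t) • (u t : L2 O))
        = -(powerL2 p (u s : L2 O) - powerL2 p (u t : L2 O))
          - (γ - cutCoeff K s) • ((u s : L2 O) - u t)
          + (cutCoeff K s - cutCoeff K t) • (u t : L2 O) := by
      simp only [smul_sub, sub_smul]
      abel
    rw [h3, inner_add_left, inner_sub_left, inner_neg_left, inner_smul_left, inner_smul_left,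
      real_inner_self_eq_norm_sq, RCLike.conj_to_real, RCLike.conj_to_real] at h1
    have h4 : (cutCoeff K s - cutCoeff K t) * inner ℝ (u t : L2 O) ((u s : L2 O) - u t)
        ≤ |cutCoeff K s - cutCoeff K t| * (‖f‖ * ‖(u s : L2 O) - u t‖) := by
      refine (le_abs_self _).trans ?_
      rw [abs_mul]
      gcongr
      refine (abs_real_inner_le_norm _ _).trans ?_
      gcongr
      exact hn t
    have h5 := mul_le_mul_of_nonneg_right (hμ1 s) (sq_nonneg ‖(u s : L2 O) - u t‖)
    rcases (norm_nonneg ((u s : L2 O) - u t)).eq_or_lt with h | h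
    · rw [← h]; positivity
    · refine le_of_mul_le_mul_right ?_ h
      nlinarith
  have hcu : Continuous fun s => (u s : L2 O) := by
    rw [continuous_iff_continuousAt]
    intro t
    have hc : Continuous fun s => |cutCoeff K s - cutCoeff K t| * ‖f‖ :=
      ((continuous_cutCoeff hK).sub continuous_const).abs.mul continuous_const
    have h0 := hc.tendsto t
    simp only [sub_self, abs_zero, zero_mul] at h0
    exact tendsto_iff_norm_sub_tendsto_zero.2 (squeeze_zero (fun _ => norm_nonneg _)
      (fun s => hd s t) h0)
  have hcE : Continuous fun s => energy p (u s) - s := by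
    simp only [hE]
    have := continuous_cutCoeff hK
    fun_prop
  have hle : ∀ s, energy p (u s) ≤ ‖f‖ ^ 2 := fun s => by
    rw [hE, sq]
    have h1 := real_inner_le_norm f (u s : L2 O)
    have h2 := mul_nonneg (zero_le_one.trans (hμ1 s)) (sq_nonneg ‖(u s : L2 O)‖)
    have h3 := mul_le_mul_of_nonneg_left (hn s) (norm_nonneg f)
    linarith
  obtain ⟨s, -, hs⟩ := intermediate_value_Icc' (sq_nonneg ‖f‖) hcE.continuousOn
    (show (0 : ℝ) ∈ Set.Icc _ _ from ⟨by linarith [hle (‖f‖ ^ 2)], by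
      rw [sub_zero]; exact energy_nonneg _⟩)
  have hs' : energy p (u s) = s := sub_eq_zero.1 hs
  refine ⟨u s, hm s, ?_⟩
  convert hu s using 1
  rw [cutg_eq, hs', sub_smul]
  abel

/-- `u ∈ L^{2p-2}(O)` means `|u|^{p-2} u ∈ L²(O)`. -/
theorem memLp_iff_memLp_powerFun (hp : 2 ≤ p) (u : L2 O) :
    MemLp u (ENNReal.ofReal (2 * p - 2)) (volume.restrict O) ↔
      MemLp (powerFun p u) 2 (volume.restrict O) := by
  have hq : 0 < p - 1 := by linarith
  have hm : AEStronglyMeasurable (powerFun p u) (volume.restrict O) :=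
    (isMonotoneC1_power hp).continuous.comp_aestronglyMeasurable (Lp.memLp u).1
  have h1 : ∀ x, ‖powerFun p u x‖ = ‖u x‖ ^ (p - 1) := fun x => abs_power hp (u x)
  rw [← memLp_norm_iff hm]
  simp_rw [h1]
  have e : ENNReal.ofReal (2 * p - 2) / ENNReal.ofReal (p - 1) = 2 := by
    rw [← ENNReal.ofReal_div_of_pos hq, show (2 * p - 2) / (p - 1) = 2 by field_simp]
    norm_num
  have := memLp_norm_rpow_iff (q := ENNReal.ofReal (p - 1)) (p := ENNReal.ofReal (2 * p - 2))
    (Lp.memLp u).1 (by simpa using hq) ENNReal.ofReal_ne_top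
  rw [e, ENNReal.toReal_ofReal hq.le] at this
  exact this.symm

theorem integral_powerFun_mul {u v : L2 O} (h : MemLp (powerFun p u) 2 (volume.restrict O)) :
    ∫ x in O, powerFun p u x * v x = inner ℝ (powerL2 p u) v := by
  rw [L2_inner_eq]
  refine integral_congr_ae ?_
  filter_upwards [coeFn_powerL2 h] with x hx
  rw [hx, powerFun]

/-- Once `|u|^{p-2} u ∈ L²(O)` for all `u ∈ D(A)`, all terms other than the Laplacian are in `L²(O)`, on
both sets. -/
theorem maxDomCutG_eq_domA (hp : 2 ≤ p) (K : ℕ)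
    (hmem : ∀ u : domA O, MemLp (powerFun p (u : L2 O)) 2 (volume.restrict O)) :
    maxDomCutG O p K = domA O := by
  ext u
  constructor
  · rintro ⟨hu, hu2, f, hf⟩
    have hm := (memLp_iff_memLp_powerFun hp u).1 hu2
    refine ⟨hu, f - powerL2 p u + cutg p K ⟨u, hu⟩, fun v => ?_⟩
    have := hf v
    rw [integral_powerFun_mul hm] at this
    rw [inner_add_left, inner_sub_left]
    linarith
  · intro hu
    have hm := hmem ⟨u, hu⟩
    refine ⟨(domA.toH10 ⟨u, hu⟩).2, (memLp_iff_memLp_powerFun hp u).2 hm, cutG p K ⟨u, hu⟩,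
      fun v => ?_⟩
    rw [integral_powerFun_mul hm, cutG, inner_sub_left, inner_add_left, ← opA_spec ⟨u, hu⟩ v]
    rfl

theorem isAccretive_cutG_add (hO : IsOpen O) {lam : ℝ} (hlam : 0 < lam)
    (hP : PoincareInequality O lam) (hp : 2 ≤ p) (K : ℕ)
    (hmem : ∀ u : domA O, MemLp (powerFun p (u : L2 O)) 2 (volume.restrict O)) {Γ : ℝ}
    (hΓ : (1 + (1 + p ^ 2) * (K : ℝ) * lam⁻¹) * (K : ℝ) ≤ Γ) :
    IsAccretive (fun u : domA O => cutG p K u + Γ • (u : L2 O)) := by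
  have key : ∀ x y : domA O, energy p (domA.toH10 y) ≤ energy p (domA.toH10 x) →
      0 ≤ (inner ℝ (cutG p K x + Γ • (x : L2 O) - (cutG p K y + Γ • (y : L2 O)))
        ((x : L2 O) - (y : L2 O)) : ℝ) := by
    intro x y hxy
    have h1 : ‖gradH10 (domA.toH10 x) - gradH10 (domA.toH10 y)‖ ^ 2
        = inner ℝ (opA x - opA y) ((x : L2 O) - (y : L2 O)) :=
      (opA_spec x).norm_sub_sq hO (opA_spec y)
    have h2 : inner ℝ (cutg p K (domA.toH10 x) - cutg p K (domA.toH10 y))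
        ((x : L2 O) - (y : L2 O)) ≤ ‖gradH10 (domA.toH10 x) - gradH10 (domA.toH10 y)‖ ^ 2
        + inner ℝ (powerL2 p (x : L2 O) - powerL2 p (y : L2 O)) ((x : L2 O) - (y : L2 O))
        + (1 + (1 + p ^ 2) * (K : ℝ) * lam⁻¹) * (K : ℝ) * ‖(x : L2 O) - (y : L2 O)‖ ^ 2 :=
      inner_cutg_sub_le hlam hP hp K (hmem x) (hmem y) hxy
    have h3 : cutG p K x + Γ • (x : L2 O) - (cutG p K y + Γ • (y : L2 O))
        = (opA x - opA y) + (powerL2 p (x : L2 O) - powerL2 p (y : L2 O))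
          - (cutg p K (domA.toH10 x) - cutg p K (domA.toH10 y))
          + Γ • ((x : L2 O) - (y : L2 O)) := by
      unfold cutG
      rw [smul_sub]
      abel
    have h6 := mul_le_mul_of_nonneg_right hΓ (sq_nonneg ‖(x : L2 O) - (y : L2 O)‖)
    rw [h3, inner_add_left, inner_sub_left, inner_add_left, inner_smul_left,
      real_inner_self_eq_norm_sq, RCLike.conj_to_real, ← h1]
    linarith
  intro x y
  rcases le_total (energy p (domA.toH10 y)) (energy p (domA.toH10 x)) with h | h
  · exact key x y h
  · have := key y x h
    rw [← inner_neg_neg, neg_sub, neg_sub] at this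
    exact this

theorem range_id_add_cutG_add (hO : IsOpen O) (hp : 2 ≤ p) (K : ℕ) {Γ : ℝ} (hΓ : K ≤ Γ) :
    Set.range (fun u : domA O => (u : L2 O) + (cutG p K u + Γ • (u : L2 O))) = Set.univ := by
  rw [Set.eq_univ_iff_forall]
  intro f
  obtain ⟨u, hm, hu⟩ := exists_cut_solution hO hp K (γ := Γ + 1) (by linarith) f
  have hud : (u : L2 O) ∈ domA O := ⟨u.2, _, hu⟩
  refine ⟨⟨u, hud⟩, ?_⟩
  have hA : opA ⟨(u : L2 O), hud⟩
      = f - powerL2 p (u : L2 O) + cutg p K u - (Γ + 1) • (u : L2 O) :=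
    (opA_spec ⟨(u : L2 O), hud⟩).unique hO hu
  have hG : cutG p K ⟨(u : L2 O), hud⟩
      = opA ⟨(u : L2 O), hud⟩ + powerL2 p (u : L2 O) - cutg p K u := rfl
  simp only [hG, hA, add_smul, one_smul]
  abel

end Range

theorem theorem3 {d : ℕ} (hd : 1 ≤ d) (O : Set (Eu d)) (hO : IsOpen O)
    (lam : ℝ) (hlam : 0 < lam) (hP : PoincareInequality O lam)
    (p : ℝ) (hp : 2 ≤ p) (hpd : 5 ≤ d → p ≤ (2 * (d : ℝ) - 4) / ((d : ℝ) - 4))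
    (K : ℕ) :
    (∀ u ∈ domA O, MemLp u (ENNReal.ofReal p) (volume.restrict O) ∧
      MemLp (powerFun p u) 2 (volume.restrict O)) ∧
    maxDomCutG O p K = domA O ∧
    ∀ Γ : ℝ, (1 + (2 + p ^ 2 * (2 : ℝ) ^ (2 * p - 3)) * (K : ℝ) * lam⁻¹) * (K : ℝ) ≤ Γ →
      IsMAccretive (fun u : domA O => cutG p K u + Γ • (u : L2 O)) := by
  have hK : (0 : ℝ) ≤ K := Nat.cast_nonneg K
  have hp0 : 0 < p := by linarith
  have hl : 0 < lam⁻¹ := inv_pos.2 hlam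
  -- The exponent `r = 4(p-1)/p` of the embedding is less than `4`, and for `d ≥ 5` the condition
  -- `r ≤ 2d/(d-2)` is exactly `p ≤ (2d-4)/(d-4)`.
  obtain ⟨C, hC, hS⟩ := exists_sobolev_H10 hd hO hlam hP (r := 4 * (p - 1) / p)
    (by rw [le_div_iff₀ hp0]; linarith) (fun _ => by rw [div_le_iff₀ hp0]; linarith) (fun h5 => by
      have h := hpd h5
      have hd5 : (5 : ℝ) ≤ d := by exact_mod_cast h5
      rw [le_div_iff₀ (by linarith)] at h
      rw [div_le_div_iff₀ hp0 (by linarith)]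
      linarith)
  have hmem : ∀ u : domA O, MemLp (powerFun p (u : L2 O)) 2 (volume.restrict O) := fun u => by
    rw [← domA.coe_toH10 u]
    exact memLp_power_of_isNegLaplacian hO hp hC hS (opA_spec u)
  have hLp : ∀ u : L2 O, MemLp (powerFun p u) 2 (volume.restrict O) →
      MemLp u (ENNReal.ofReal p) (volume.restrict O) := fun u h => by
    rw [← integrable_norm_rpow_iff (Lp.memLp u).1 (by simpa using hp0) ENNReal.ofReal_ne_top,
      ENNReal.toReal_ofReal hp0.le]
    exact integrable_abs_rpow hp h
  constructor
  · intro u hu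
    have h := hmem ⟨u, hu⟩
    exact ⟨hLp u h, h⟩
  refine ⟨maxDomCutG_eq_domA hp K hmem, fun Γ hΓ => ⟨?_, ?_⟩⟩
  · refine isAccretive_cutG_add hO hlam hP hp K hmem (le_trans ?_ hΓ)
    have h4 : (1 : ℝ) ≤ (2 : ℝ) ^ (2 * p - 3) := Real.one_le_rpow (by norm_num) (by linarith)
    have h5 := le_mul_of_one_le_right (sq_nonneg p) h4
    gcongr
    linarith
  · refine range_id_add_cutG_add hO hp K (le_trans ?_ hΓ)
    refine le_mul_of_one_le_left hK (le_add_of_nonneg_right ?_)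
    positivity
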